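/- \textbf{Setting.} Let $m\ge 1$, $n\ge 0$. Agents $i\in\mathcal M=\{1,\dots,m\}$ have convex functions $f_i:\mathbb R^n\to\mathbb R$ and nonempty closed convex sets $X_i\subseteq\mathbb R^n$; $P_{X_i}$ is Euclidean projection onto $X_i$ and $\|\cdot\|$ the Euclidean norm. Let $n(0),n(1),\dots$ be i.i.d. random elements of a measurable space $\Omega'$ (the coordinates of the product probability space $\prod_{k}(\Omega',P')$), let $\psi:(\mathbb R^n)^m\times\Omega'\to\mathbb R^{m\times m}$ be measurable, and let $\alpha(k)>0$ be stepsizes. Starting from deterministic $x_i(0)\in X_i$, the states $x(k)=(x_i(k))_{i\in\mathcal M}$ evolve by $$A(k)=[a_{ij}(k)]=\psi(x(k),n(k)),\quad v_i(k)=\sum_{j=1}^m a_{ij}(k)x_j(k),\quad x_i(k+1)=P_{X_i}\big[v_i(k)-\alpha(k)d_i(k)\big],$$ where $d_i(k)$ is a subgradient of $f_i$ at $v_i(k)$, chosen as a measurable function of $(x(k),n(k))$ which may depend on $k$ and $i$. The projection errors are $e_i(k)=P_{X_i}[v_i(k)-\alpha(k)d_i(k)]-(v_i(k)-\alpha(k)d_i(k))$.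 Thus $x(k)$ is a (time-nonhomogeneous) Markov chain. For a state $\bar x\in(\mathbb R^n)^m$, write $P(\,\cdot\mid x(s)=\bar x)$ and $E[\,\cdot\mid x(s)=\bar x]$ for the law and expectation of the process $(x(k),A(k))_{k\ge s}$ obtained by running the recursion from time $s$ with $x(s)=\bar x$ and the independent noise $n(s),n(s+1),\dots$. \textbf{Assumptions.} \begin{itemize} \item (Bounded subgradients) $L>0$ and $\|d\|\le L$ for all $i$, all $x\in\mathbb R^n$ and all $d\in\partial f_i(x)$. \item (Connectivity) $(\mathcal M,\mathcal E)$ is a strongly connected directed graph, and there are $\gamma,K,C>0$, $\delta\in(0,1]$ such that for all $(j,i)\in\mathcal E$, all $\bar x\in(\mathbb R^n)^m$ and all $k\ge0$, $$P(a_{ij}(k)\ge\gamma\mid x(k)=\bar x)\ge\min\Big\{\delta,\frac{K}{\|\bar x_i-\bar x_j\|^C}\Big\}\qquad(K/0=\infty).$$ \item With probability one, for all $k\ge0$: (doubly stochastic weights) $A(k)$ is doubly stochastic; (self-confidence) $a_{ii}(k)\ge\gamma$ for all $i$; (projection errors) $\|e_i(k)\|\le M\alpha(k)$ for all $i$, where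 $M>0$ is a constant. \item (Limiting stepsizes) $\lim_{k\to\infty}k\log^p(k)\,\alpha(k)=0$ for every real $p<1$. \end{itemize} \textbf{Notation.} For $k\ge s\ge 0$ let $\Phi(k,s)=A(k)A(k-1)\cdots A(s)$ and $$\rho(k,s)=\max_{i,j\in\mathcal M}\Big|[\Phi(k,s)]_{ij}-\frac1m\Big|.$$ With $\Delta=2m\max_{j}\|x_j(0)\|$ let $$R_M(s)=\Big\{x\in(\mathbb R^n)^m:\ \max_{i,h\in\mathcal M}\|x_i-x_h\|\le\Delta+2m(L+M)\sum_{r=0}^{s-1}\alpha(r)\Big\}.$$ \textbf{Proposition.} Under these assumptions there are $\mu>0$, an increasing function $\beta:\mathbb N\to[0,\infty)$ and a function $S:(0,\infty)\to\mathbb N$ with $\beta(s)\le s^q$ for all real $q>0$ and all $s\ge S(q)$, such that for all $k\ge s\ge0$: \begin{enumerate} \item[(i)] $E[\rho(k,s)\mid x(s)=\bar x]\le\beta(s)e^{-\mu\sqrt{k-s}}$ for every $\bar x\in R_M(s)$ such that the three almost sure properties assumed of the process (doubly stochastic $A(k')$, $a_{ii}(k')\ge\gamma$, $\|e_i(k')\|\le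 M\alpha(k')$, for all $i$ and all $k'\ge s$) hold with probability one given $x(s)=\bar x$; \item[(ii)] for the process started from $x(0)$, almost surely $E[\rho(k,s)\mid x(s)]\le\beta(s)e^{-\mu\sqrt{k-s}}$. \end{enumerate} The random variables $\rho(k,s)$ in (i) and (ii) are integrable, and the same $\mu$ and $\beta$ also work if $\Phi(k,s)$ is replaced by the product $A(s)A(s+1)\cdots A(k)$ in the opposite order. -/

import Mathlib

open MeasureTheory Filter Topology

/-- The joint state of `m` agents: one vector of the Euclidean space `ℝⁿ` for each agent. -/
abbrev AgentState (m n : ℕ) : Type := Fin m → EuclideanSpace ℝ (Fin n)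

/-- The set `∂f(x)` of subgradients at `x` of a real-valued function on `ℝⁿ`. -/
def subgradients {n : ℕ} (f : EuclideanSpace ℝ (Fin n) → ℝ) (x : EuclideanSpace ℝ (Fin n)) :
    Set (EuclideanSpace ℝ (Fin n)) :=
  {g | ∀ y, f x + inner ℝ g (y - x) ≤ f y}

/-- The projection of `x` on `X`, i.e. the minimizer of `‖x - y‖` over `y ∈ X`
(it exists and is unique if `X` is nonempty, closed and convex). -/
noncomputable def projOn {n : ℕ} (X : Set (EuclideanSpace ℝ (Fin n)))
    (x : EuclideanSpace ℝ (Fin n)) : EuclideanSpace ℝ (Fin n) :=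
  Classical.epsilon fun y => y ∈ X ∧ IsMinOn (fun z => ‖x - z‖) X y

/-- The data of the projected multi-agent subgradient algorithm with `m` agents in `ℝⁿ` and
state-dependent communication. The noise at each time takes values in `W`. -/
structure SubgradientNetwork (m n : ℕ) (W : Type*) [MeasurableSpace W] where
  /-- local objective functions -/
  f : Fin m → EuclideanSpace ℝ (Fin n) → ℝ
  convex_f : ∀ i, ConvexOn ℝ Set.univ (f i)
  /-- local constraint sets -/
  X : Fin m → Set (EuclideanSpace ℝ (Fin n))
  nonempty_X : ∀ i, (X i).Nonempty
  closed_X : ∀ i, IsClosed (X i)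
  convex_X : ∀ i, Convex ℝ (X i)
  /-- stepsizes -/
  α : ℕ → ℝ
  α_pos : ∀ k, 0 < α k
  /-- the communication matrix as a function of the state and of the noise -/
  ψ : AgentState m n → W → Matrix (Fin m) (Fin m) ℝ
  measurable_ψ : ∀ i j, Measurable fun p : AgentState m n × W => ψ p.1 p.2 i j
  /-- the subgradient used by an agent at a time, given the state and the noise at that time -/
  d : ℕ → Fin m → AgentState m n → W → EuclideanSpace ℝ (Fin n)
  measurable_d : ∀ k i, Measurable fun p : AgentState m n × W => d k i p.1 p.2
  d_mem : ∀ k i x w, d k i x w ∈ subgradients (f i) (∑ j, ψ x w i j • x j)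
  /-- initial estimates -/
  x₀ : AgentState m n
  x₀_mem : ∀ i, x₀ i ∈ X i

namespace SubgradientNetwork

variable {m n : ℕ} {W : Type*} [MeasurableSpace W]

/-- The point `v_i - α(k) d_i` with `v_i = ∑ⱼ a_ij x_j`, before projection. -/
noncomputable def preStep (N : SubgradientNetwork m n W) (k : ℕ) (x : AgentState m n) (w : W) :
    AgentState m n :=
  fun i => ∑ j, N.ψ x w i j • x j - N.α k • N.d k i x w

/-- The state at time `k + 1`, if the state at time `k` is `x` and the noise is `w`. -/
noncomputable def step (N : SubgradientNetwork m n W) (k : ℕ) (x : AgentState m n) (w : W) :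
    AgentState m n :=
  fun i => projOn (N.X i) (N.preStep k x w i)

/-- The projection error `e_i(k)`, if the state at time `k` is `x` and the noise is `w`. -/
noncomputable def projError (N : SubgradientNetwork m n W) (k : ℕ) (x : AgentState m n) (w : W)
    (i : Fin m) : EuclideanSpace ℝ (Fin n) :=
  projOn (N.X i) (N.preStep k x w i) - N.preStep k x w i

/-- The state at time `k` of the algorithm that is in state `y` at time `s`, along the noise
sequence `ω` (only meaningful for `s ≤ k`; it is `y` for `k ≤ s`). -/
noncomputable def stateFrom (N : SubgradientNetwork m n W) (s : ℕ) (y : AgentState m n)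
    (ω : ℕ → W) : ℕ → AgentState m n
  | 0 => y
  | k + 1 => if s ≤ k then N.step k (N.stateFrom s y ω k) (ω k) else y

/-- The communication matrix `A(k) = ψ(x(k), n(k))` of the algorithm in state `y` at time `s`. -/
noncomputable def weightsFrom (N : SubgradientNetwork m n W) (s : ℕ) (y : AgentState m n)
    (ω : ℕ → W) (k : ℕ) : Matrix (Fin m) (Fin m) ℝ :=
  N.ψ (N.stateFrom s y ω k) (ω k)

/-- The law of the noise sequence: independent, with common law `P`. -/
noncomputable def noiseLaw (P : Measure W) [IsProbabilityMeasure P] : Measure (ℕ → W) :=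
  Measure.infinitePi fun _ : ℕ => P

/-- With probability one, all communication matrices of the algorithm that is in state `y` at time
`s` are doubly stochastic from time `s` on. -/
def DoublyStochasticFrom (N : SubgradientNetwork m n W) (P : Measure W) [IsProbabilityMeasure P]
    (s : ℕ) (y : AgentState m n) : Prop :=
  ∀ᵐ ω ∂(noiseLaw P), ∀ k, s ≤ k → N.weightsFrom s y ω k ∈ doublyStochastic ℝ (Fin m)

/-- With probability one, all agents of the algorithm that is in state `y` at time `s` give weight
at least `γ` to themselves from time `s` on. -/
def SelfConfidentFrom (N : SubgradientNetwork m n W) (P : Measure W) [IsProbabilityMeasure P]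
    (γ : ℝ) (s : ℕ) (y : AgentState m n) : Prop :=
  ∀ᵐ ω ∂(noiseLaw P), ∀ k, s ≤ k → ∀ i, γ ≤ N.weightsFrom s y ω k i i

/-- With probability one, the projection errors of the algorithm that is in state `y` at time `s`
are bounded by `M α(k)` from time `s` on. -/
def ProjErrorBoundedFrom (N : SubgradientNetwork m n W) (P : Measure W) [IsProbabilityMeasure P]
    (M : ℝ) (s : ℕ) (y : AgentState m n) : Prop :=
  ∀ᵐ ω ∂(noiseLaw P), ∀ k, s ≤ k → ∀ i,
    ‖N.projError k (N.stateFrom s y ω k) (ω k) i‖ ≤ M * N.α k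

/-- The set `R_M(k)`, with `L` the bound on the subgradients. -/
def reachable (N : SubgradientNetwork m n W) (L M : ℝ) (k : ℕ) : Set (AgentState m n) :=
  {x | ∀ i h, ‖x i - x h‖ ≤
    2 * m * (⨆ j, ‖N.x₀ j‖) + 2 * m * (L + M) * ∑ r ∈ Finset.range k, N.α r}

end SubgradientNetwork

/-- The product `A(k) A(k-1) ⋯ A(s)`, for `s ≤ k`. -/
noncomputable def backwardProduct {m : ℕ} (A : ℕ → Matrix (Fin m) (Fin m) ℝ) (k s : ℕ) :
    Matrix (Fin m) (Fin m) ℝ :=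
  ((List.range' s (k + 1 - s)).reverse.map A).prod

/-- The product `A(s) A(s+1) ⋯ A(k)`, for `s ≤ k`. -/
noncomputable def forwardProduct {m : ℕ} (A : ℕ → Matrix (Fin m) (Fin m) ℝ) (k s : ℕ) :
    Matrix (Fin m) (Fin m) ℝ :=
  ((List.range' s (k + 1 - s)).map A).prod

/-- `max_{i,j} |Φ_ij - 1/m|`. -/
noncomputable def disagreement {m : ℕ} (Φ : Matrix (Fin m) (Fin m) ℝ) : ℝ :=
  ⨆ p : Fin m × Fin m, |Φ p.1 p.2 - 1 / (m : ℝ)|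

section Matrices

variable {m : ℕ}

/-- The squared Frobenius distance of a matrix from the averaging matrix. -/
noncomputable def averagingEnergy (Q : Matrix (Fin m) (Fin m) ℝ) : ℝ :=
  ∑ l, ∑ i, (Q i l - 1 / (m : ℝ)) ^ 2

lemma averagingEnergy_nonneg (Q : Matrix (Fin m) (Fin m) ℝ) : 0 ≤ averagingEnergy Q :=
  Finset.sum_nonneg fun _ _ => Finset.sum_nonneg fun _ _ => sq_nonneg _

lemma abs_sub_inv_card_le_one (hm : 0 < m) {Q : Matrix (Fin m) (Fin m) ℝ}
    (hQ : Q ∈ doublyStochastic ℝ (Fin m)) (i j : Fin m) : |Q i j - 1 / (m : ℝ)| ≤ 1 := by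
  have h1 := nonneg_of_mem_doublyStochastic hQ (i := i) (j := j)
  have h2 := le_one_of_mem_doublyStochastic hQ (i := i) (j := j)
  have h3 : 0 ≤ 1 / (m : ℝ) := by positivity
  have h4 : 1 / (m : ℝ) ≤ 1 := by
    rw [div_le_one (by exact_mod_cast hm)]; exact_mod_cast hm
  rw [abs_le]; constructor <;> linarith

lemma averagingEnergy_le (hm : 0 < m) {Q : Matrix (Fin m) (Fin m) ℝ}
    (hQ : Q ∈ doublyStochastic ℝ (Fin m)) : averagingEnergy Q ≤ (m : ℝ) * m := by
  have : averagingEnergy Q ≤ ∑ _l : Fin m, ∑ _i : Fin m, (1 : ℝ) :=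
    Finset.sum_le_sum fun l _ => Finset.sum_le_sum fun i _ => by
      rw [sq_le_one_iff_abs_le_one]; exact abs_sub_inv_card_le_one hm hQ i l
  simpa using this

lemma disagreement_nonneg (Q : Matrix (Fin m) (Fin m) ℝ) : 0 ≤ disagreement Q :=
  Real.iSup_nonneg fun _ => abs_nonneg _

lemma disagreement_le_one (hm : 0 < m) {Q : Matrix (Fin m) (Fin m) ℝ}
    (hQ : Q ∈ doublyStochastic ℝ (Fin m)) : disagreement Q ≤ 1 :=
  Real.iSup_le (fun p => abs_sub_inv_card_le_one hm hQ p.1 p.2) zero_le_one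

lemma disagreement_transpose (Q : Matrix (Fin m) (Fin m) ℝ) :
    disagreement Q.transpose = disagreement Q :=
  (Equiv.prodComm (Fin m) (Fin m)).iSup_congr fun _ => rfl

lemma disagreement_sq_le_averagingEnergy (Q : Matrix (Fin m) (Fin m) ℝ) :
    disagreement Q ^ 2 ≤ averagingEnergy Q := by
  have h : disagreement Q ≤ √(averagingEnergy Q) := by
    refine Real.iSup_le (fun p => Real.abs_le_sqrt ?_) (Real.sqrt_nonneg _)
    calc (Q p.1 p.2 - 1 / (m : ℝ)) ^ 2 ≤ ∑ i, (Q i p.2 - 1 / (m : ℝ)) ^ 2 :=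
          Finset.single_le_sum (f := fun i => (Q i p.2 - 1 / (m : ℝ)) ^ 2)
            (fun _ _ => sq_nonneg _) (Finset.mem_univ _)
      _ ≤ _ := Finset.single_le_sum (f := fun l => ∑ i, (Q i l - 1 / (m : ℝ)) ^ 2)
            (fun _ _ => Finset.sum_nonneg fun _ _ => sq_nonneg _) (Finset.mem_univ _)
  calc disagreement Q ^ 2 ≤ √(averagingEnergy Q) ^ 2 :=
        pow_le_pow_left₀ (disagreement_nonneg Q) h 2
    _ = _ := Real.sq_sqrt (averagingEnergy_nonneg Q)

lemma measurable_averagingEnergy {Ω : Type*} [MeasurableSpace Ω]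
    {Q : Ω → Matrix (Fin m) (Fin m) ℝ} (hQ : ∀ i j, Measurable fun ω => Q ω i j) :
    Measurable fun ω => averagingEnergy (Q ω) := by
  unfold averagingEnergy
  fun_prop

lemma measurable_disagreement {Ω : Type*} [MeasurableSpace Ω]
    {Q : Ω → Matrix (Fin m) (Fin m) ℝ} (hQ : ∀ i j, Measurable fun ω => Q ω i j) :
    Measurable fun ω => disagreement (Q ω) := by
  unfold disagreement
  exact Measurable.iSup fun p => ((hQ p.1 p.2).sub_const _).abs

lemma measurable_matrix_mul {Ω : Type*} [MeasurableSpace Ω]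
    {Q R : Ω → Matrix (Fin m) (Fin m) ℝ} (hQ : ∀ i j, Measurable fun ω => Q ω i j)
    (hR : ∀ i j, Measurable fun ω => R ω i j) (i j : Fin m) :
    Measurable fun ω => (Q ω * R ω) i j := by
  simp only [Matrix.mul_apply]
  fun_prop

/-- A weighted average decreases the square by at least the part of the variance that involves a
given index. -/
lemma sq_sum_mul_add_le {ι : Type*} [Fintype ι] (a z : ι → ℝ) (ha : ∀ j, 0 ≤ a j)
    (hs : ∑ j, a j = 1) (i : ι) :
    (∑ j, a j * z j) ^ 2 + a i / 2 * ∑ j, a j * (z i - z j) ^ 2 ≤ ∑ j, a j * z j ^ 2 := by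
  have h1 : ∑ l, a l * ∑ j, a j * (z l - z j) ^ 2
      = 2 * (∑ j, a j * z j ^ 2 - (∑ j, a j * z j) ^ 2) := by
    have h2 : ∀ l, a l * ∑ j, a j * (z l - z j) ^ 2 =
        a l * z l ^ 2 - 2 * (a l * z l) * (∑ j, a j * z j) + a l * ∑ j, a j * z j ^ 2 := by
      intro l
      have : ∑ j, a j * (z l - z j) ^ 2
          = ∑ j, (z l ^ 2 * a j - 2 * z l * (a j * z j) + a j * z j ^ 2) :=
        Finset.sum_congr rfl fun j _ => by ring
      rw [this, Finset.sum_add_distrib, Finset.sum_sub_distrib, ← Finset.mul_sum,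
        ← Finset.mul_sum, hs]
      ring
    rw [Finset.sum_congr rfl fun l _ => h2 l, Finset.sum_add_distrib, Finset.sum_sub_distrib,
      ← Finset.sum_mul, ← Finset.sum_mul, ← Finset.mul_sum, hs]
    ring
  have h3 : a i * ∑ j, a j * (z i - z j) ^ 2 ≤ ∑ l, a l * ∑ j, a j * (z l - z j) ^ 2 :=
    Finset.single_le_sum (f := fun l => a l * ∑ j, a j * (z l - z j) ^ 2)
      (fun l _ => mul_nonneg (ha l) <| Finset.sum_nonneg fun j _ =>
        mul_nonneg (ha j) (sq_nonneg _)) (Finset.mem_univ i)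
  linarith

lemma sum_sq_mulVec_add_le {A : Matrix (Fin m) (Fin m) ℝ} (hA : A ∈ doublyStochastic ℝ (Fin m))
    {γ : ℝ} (hself : ∀ i, γ ≤ A i i) (z : Fin m → ℝ) :
    ∑ i, (∑ j, A i j * z j) ^ 2 + γ / 2 * ∑ i, ∑ j, A i j * (z i - z j) ^ 2 ≤ ∑ i, z i ^ 2 := by
  have h0 : ∀ i j, 0 ≤ A i j := fun i j => nonneg_of_mem_doublyStochastic hA
  have h1 : ∀ i, (∑ j, A i j * z j) ^ 2 + γ / 2 * ∑ j, A i j * (z i - z j) ^ 2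
      ≤ ∑ j, A i j * z j ^ 2 := fun i => by
    have h2 := sq_sum_mul_add_le (A i) z (h0 i) (sum_row_of_mem_doublyStochastic hA i) i
    have h3 : γ / 2 * ∑ j, A i j * (z i - z j) ^ 2 ≤ A i i / 2 * ∑ j, A i j * (z i - z j) ^ 2 :=
      mul_le_mul_of_nonneg_right (by linarith [hself i])
        (Finset.sum_nonneg fun j _ => mul_nonneg (h0 i j) (sq_nonneg _))
    linarith
  have h4 := Finset.sum_le_sum fun i (_ : i ∈ Finset.univ) => h1 i
  rw [Finset.sum_add_distrib, ← Finset.mul_sum, Finset.sum_comm (f := fun i j => A i j * z j ^ 2)]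
    at h4
  simpa only [← Finset.sum_mul, sum_col_of_mem_doublyStochastic hA, one_mul] using h4

lemma averagingEnergy_mul_add_le {A Z : Matrix (Fin m) (Fin m) ℝ}
    (hA : A ∈ doublyStochastic ℝ (Fin m)) {γ : ℝ} (hself : ∀ i, γ ≤ A i i) :
    averagingEnergy (A * Z) + γ / 2 * ∑ l, ∑ i, ∑ j, A i j * (Z i l - Z j l) ^ 2
      ≤ averagingEnergy Z := by
  have h : ∀ l, ∑ i, ((A * Z) i l - 1 / (m : ℝ)) ^ 2
      + γ / 2 * ∑ i, ∑ j, A i j * (Z i l - Z j l) ^ 2 ≤ ∑ i, (Z i l - 1 / (m : ℝ)) ^ 2 := by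
    intro l
    have h1 := sum_sq_mulVec_add_le hA hself fun i => Z i l - 1 / (m : ℝ)
    have h2 : ∀ i, ∑ j, A i j * (Z j l - 1 / (m : ℝ)) = (A * Z) i l - 1 / (m : ℝ) := fun i => by
      simp only [mul_sub, Finset.sum_sub_distrib, ← Finset.sum_mul,
        sum_row_of_mem_doublyStochastic hA, one_mul, Matrix.mul_apply]
    simpa only [h2, sub_sub_sub_cancel_right] using h1
  have h4 := Finset.sum_le_sum fun l (_ : l ∈ Finset.univ) => h l
  rwa [Finset.sum_add_distrib, ← Finset.mul_sum] at h4

lemma exists_sq_sub_le_of_reflTransGen {E : Fin m → Fin m → Prop} {i j : Fin m}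
    (h : Relation.ReflTransGen E i j) :
    ∃ c : ℝ, 0 ≤ c ∧ ∀ (b : Fin m → Fin m → ℝ) (p : ℝ), 0 ≤ p → (∀ i j, 0 ≤ b i j) →
      (∀ i j, E i j → p ≤ b i j) → ∀ z : Fin m → ℝ,
        p * (z i - z j) ^ 2 ≤ c * ∑ i, ∑ j, b i j * (z i - z j) ^ 2 := by
  induction h with
  | refl =>
    exact ⟨0, le_rfl, fun b p _ _ _ z => by simp⟩
  | @tail j k _ hjk ih =>
    obtain ⟨c, hc, ih⟩ := ih
    refine ⟨2 * c + 2, by positivity, fun b p hp hb hE z => ?_⟩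
    have h1 := ih b p hp hb hE z
    have h2 : p * (z j - z k) ^ 2 ≤ ∑ i, ∑ j, b i j * (z i - z j) ^ 2 :=
      calc p * (z j - z k) ^ 2 ≤ b j k * (z j - z k) ^ 2 :=
            mul_le_mul_of_nonneg_right (hE j k hjk) (sq_nonneg _)
        _ ≤ ∑ l, b j l * (z j - z l) ^ 2 :=
            Finset.single_le_sum (f := fun l => b j l * (z j - z l) ^ 2)
              (fun l _ => mul_nonneg (hb j l) (sq_nonneg _)) (Finset.mem_univ k)
        _ ≤ _ := Finset.single_le_sum (f := fun i => ∑ j, b i j * (z i - z j) ^ 2)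
              (fun i _ => Finset.sum_nonneg fun l _ => mul_nonneg (hb i l) (sq_nonneg _))
              (Finset.mem_univ j)
    have h3 : p * (z i - z k) ^ 2 ≤ 2 * (p * (z i - z j) ^ 2) + 2 * (p * (z j - z k) ^ 2) := by
      have : 0 ≤ p * ((z i - z j) - (z j - z k)) ^ 2 := by positivity
      nlinarith
    nlinarith

/-- A Poincaré inequality on a strongly connected graph. -/
lemma exists_mul_averagingEnergy_le (hm : 0 < m) {E : Fin m → Fin m → Prop}
    (hE : ∀ i j, Relation.ReflTransGen E i j) :
    ∃ c : ℝ, 0 < c ∧ ∀ (b : Fin m → Fin m → ℝ) (p : ℝ), 0 ≤ p → (∀ i j, 0 ≤ b i j) →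
      (∀ i j, E i j → p ≤ b i j) → ∀ Z ∈ doublyStochastic ℝ (Fin m),
        c * p * averagingEnergy Z ≤ ∑ l, ∑ i, ∑ j, b i j * (Z i l - Z j l) ^ 2 := by
  choose c hc h using fun i j => exists_sq_sub_le_of_reflTransGen (hE i j)
  set T : ℝ := ∑ i, ∑ j, c i j with hT
  have hT0 : 0 ≤ T := Finset.sum_nonneg fun i _ => Finset.sum_nonneg fun j _ => hc i j
  have hm' : (0 : ℝ) < m := by exact_mod_cast hm
  refine ⟨1 / (T + 1), by positivity, fun b p hp hb hpb Z hZ => ?_⟩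
  unfold averagingEnergy
  rw [Finset.mul_sum]
  refine Finset.sum_le_sum fun l _ => ?_
  set D : ℝ := ∑ i, ∑ j, b i j * (Z i l - Z j l) ^ 2
  have hD : 0 ≤ D := Finset.sum_nonneg fun i _ => Finset.sum_nonneg fun j _ =>
    mul_nonneg (hb i j) (sq_nonneg _)
  have h1 : ∀ i, p * (Z i l - 1 / (m : ℝ)) ^ 2 ≤ ∑ j, c i j * D := by
    intro i
    have h2 : Z i l - 1 / (m : ℝ) = (1 / (m : ℝ)) * ∑ j, (Z i l - Z j l) := by
      rw [Finset.sum_sub_distrib, sum_col_of_mem_doublyStochastic hZ]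
      simp; field_simp
    have h3 : (∑ j, (Z i l - Z j l)) ^ 2 ≤ m * ∑ j, (Z i l - Z j l) ^ 2 := by
      simpa using sq_sum_le_card_mul_sum_sq (s := Finset.univ) (f := fun j => Z i l - Z j l)
    have h4 : (Z i l - 1 / (m : ℝ)) ^ 2 ≤ ∑ j, (Z i l - Z j l) ^ 2 := by
      rw [h2, mul_pow, one_div, inv_pow, inv_mul_le_iff₀ (by positivity)]
      refine h3.trans (mul_le_mul_of_nonneg_right ?_ (Finset.sum_nonneg fun _ _ => sq_nonneg _))
      have : (1 : ℝ) ≤ m := by exact_mod_cast hm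
      nlinarith
    calc _ ≤ p * ∑ j, (Z i l - Z j l) ^ 2 := mul_le_mul_of_nonneg_left h4 hp
      _ = ∑ j, p * (Z i l - Z j l) ^ 2 := Finset.mul_sum ..
      _ ≤ _ := Finset.sum_le_sum fun j _ => h i j b p hp hb hpb fun i => Z i l
  have h5 : p * ∑ i, (Z i l - 1 / (m : ℝ)) ^ 2 ≤ T * D := by
    rw [Finset.mul_sum, hT, Finset.sum_mul]
    exact Finset.sum_le_sum fun i _ => (h1 i).trans_eq (Finset.sum_mul ..).symm
  rw [mul_assoc, one_div, inv_mul_le_iff₀ (by positivity)]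
  nlinarith

lemma integral_averagingEnergy_mul_le (hm : 0 < m) {W : Type*} [MeasurableSpace W] (P : Measure W)
    [IsProbabilityMeasure P] {E : Fin m → Fin m → Prop} {γ c p : ℝ} (hγ : 0 < γ) (hp : 0 ≤ p)
    (hc : ∀ (b : Fin m → Fin m → ℝ) (p : ℝ), 0 ≤ p → (∀ i j, 0 ≤ b i j) →
      (∀ i j, E i j → p ≤ b i j) → ∀ Z ∈ doublyStochastic ℝ (Fin m),
        c * p * averagingEnergy Z ≤ ∑ l, ∑ i, ∑ j, b i j * (Z i l - Z j l) ^ 2)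
    {A : W → Matrix (Fin m) (Fin m) ℝ} (hA : ∀ i j, Measurable fun w => A w i j)
    (hds : ∀ᵐ w ∂P, A w ∈ doublyStochastic ℝ (Fin m)) (hself : ∀ᵐ w ∂P, ∀ i, γ ≤ A w i i)
    (hpE : ∀ i j, E i j → p ≤ P.real {w | γ ≤ A w i j})
    {Z : Matrix (Fin m) (Fin m) ℝ} (hZ : Z ∈ doublyStochastic ℝ (Fin m)) :
    Integrable (fun w => averagingEnergy (A w * Z)) P ∧
    ∫ w, averagingEnergy (A w * Z) ∂P
      ≤ Real.exp (-(γ ^ 2 * c / 2 * p)) * averagingEnergy Z := by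
  have hint : Integrable (fun w => averagingEnergy (A w * Z)) P := by
    have hmeas : Measurable fun w => averagingEnergy (A w * Z) :=
      measurable_averagingEnergy (Q := fun w => A w * Z)
        (measurable_matrix_mul (R := fun _ => Z) hA fun _ _ => measurable_const)
    refine Integrable.of_bound hmeas.aestronglyMeasurable ((m : ℝ) * m) ?_
    filter_upwards [hds] with w hw
    rw [Real.norm_of_nonneg (averagingEnergy_nonneg _)]
    exact averagingEnergy_le hm (mul_mem hw hZ)
  have hAint : ∀ i j, Integrable (fun w => A w i j) P := fun i j => by
    refine Integrable.of_bound (hA i j).aestronglyMeasurable 1 ?_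
    filter_upwards [hds] with w hw
    rw [Real.norm_of_nonneg (nonneg_of_mem_doublyStochastic hw)]
    exact le_one_of_mem_doublyStochastic hw
  refine ⟨hint, ?_⟩
  set b : Fin m → Fin m → ℝ := fun i j => ∫ w, A w i j ∂P with hb
  have hnn : ∀ i j, 0 ≤ᵐ[P] fun w => A w i j := fun i j => by
    filter_upwards [hds] with w hw using nonneg_of_mem_doublyStochastic hw
  have hb0 : ∀ i j, 0 ≤ b i j := fun i j => integral_nonneg_of_ae (hnn i j)
  have hbE : ∀ i j, E i j → γ * p ≤ b i j := fun i j hij =>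
    (mul_le_mul_of_nonneg_left (hpE i j hij) hγ.le).trans
      (mul_meas_ge_le_integral_of_nonneg (hnn i j) (hAint i j) γ)
  have h1 := hc b (γ * p) (by positivity) hb0 hbE Z hZ
  have hint2 : Integrable
      (fun w => γ / 2 * ∑ l, ∑ i, ∑ j, A w i j * (Z i l - Z j l) ^ 2) P :=
    (integrable_finsetSum _ fun l _ => integrable_finsetSum _ fun i _ =>
      integrable_finsetSum _ fun j _ => (hAint i j).mul_const _).const_mul _
  have h2 : ∫ w, (averagingEnergy (A w * Z)
      + γ / 2 * ∑ l, ∑ i, ∑ j, A w i j * (Z i l - Z j l) ^ 2) ∂P ≤ averagingEnergy Z := by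
    have := integral_mono_ae (hint.add hint2) (integrable_const (averagingEnergy Z)) (by
      filter_upwards [hds, hself] with w h1 h2 using averagingEnergy_mul_add_le h1 h2)
    simpa using this
  have h3 : ∫ w, (γ / 2 * ∑ l, ∑ i, ∑ j, A w i j * (Z i l - Z j l) ^ 2) ∂P
      = γ / 2 * ∑ l, ∑ i, ∑ j, b i j * (Z i l - Z j l) ^ 2 := by
    rw [integral_const_mul, integral_finsetSum _ fun l _ => integrable_finsetSum _ fun i _ =>
      integrable_finsetSum _ fun j _ => (hAint i j).mul_const _]
    congr 1
    refine Finset.sum_congr rfl fun l _ => ?_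
    rw [integral_finsetSum _ fun i _ =>
      integrable_finsetSum _ fun j _ => (hAint i j).mul_const _]
    refine Finset.sum_congr rfl fun i _ => ?_
    rw [integral_finsetSum _ fun j _ => (hAint i j).mul_const _]
    exact Finset.sum_congr rfl fun j _ => integral_mul_const ..
  rw [integral_add hint hint2, h3] at h2
  have h4 : (1 - γ ^ 2 * c / 2 * p) * averagingEnergy Z
      ≤ Real.exp (-(γ ^ 2 * c / 2 * p)) * averagingEnergy Z :=
    mul_le_mul_of_nonneg_right (Real.one_sub_le_exp_neg _) (averagingEnergy_nonneg Z)
  nlinarith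

end Matrices

section RealBounds

lemma one_le_log_add_three (k : ℕ) : 1 ≤ Real.log ((k : ℝ) + 3) := by
  rw [Real.le_log_iff_exp_le (by positivity)]
  have := Real.exp_one_lt_d9
  have : (0 : ℝ) ≤ k := k.cast_nonneg
  linarith

lemma div_mul_log_rpow_le_sub {ε : ℝ} (hε : 0 < ε) (hε1 : ε ≤ 1) (k : ℕ) :
    ε / (((k : ℝ) + 4) * Real.log ((k : ℝ) + 4) ^ (1 - ε))
      ≤ Real.log ((k : ℝ) + 4) ^ ε - Real.log ((k : ℝ) + 3) ^ ε := by
  have hk : (0 : ℝ) ≤ k := k.cast_nonneg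
  set b := Real.log ((k : ℝ) + 4) with hb
  set a := Real.log ((k : ℝ) + 3) with ha
  have ha1 : 1 ≤ a := one_le_log_add_three k
  have hba : 1 / ((k : ℝ) + 4) ≤ b - a := by
    rw [hb, ha, ← Real.log_div (by positivity) (by positivity)]
    refine le_trans (le_of_eq ?_) (Real.one_sub_inv_le_log_of_pos (by positivity))
    field_simp; ring
  have hb0 : 0 < b := by
    have : 0 < 1 / ((k : ℝ) + 4) := by positivity
    linarith
  have h1 : (a / b) ^ ε ≤ 1 + ε * (a / b - 1) := by
    have := rpow_one_add_le_one_add_mul_self (s := a / b - 1)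
      (by have : 0 ≤ a / b := by positivity
          linarith) hε.le hε1
    simpa using this
  rw [Real.div_rpow (by positivity) hb0.le, div_le_iff₀ (by positivity)] at h1
  have h2 : b ^ (1 - ε) * b ^ ε = b := by
    rw [← Real.rpow_add hb0]; simp
  have h3 : 0 < b ^ (1 - ε) := by positivity
  have h4 : 0 < b ^ ε := by positivity
  have h5 : b ^ ε = b / b ^ (1 - ε) := by rw [eq_div_iff h3.ne', mul_comm]; exact h2
  calc ε / (((k : ℝ) + 4) * b ^ (1 - ε)) = ε / b ^ (1 - ε) * (1 / ((k : ℝ) + 4)) := by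
        field_simp
    _ ≤ ε / b ^ (1 - ε) * (b - a) := by gcongr
    _ = b ^ ε - (1 + ε * (a / b - 1)) * b ^ ε := by
        rw [h5]; field_simp; ring
    _ ≤ b ^ ε - a ^ ε := by linarith

/-- Partial sums of stepsizes that decrease faster than `1 / (k log^p k)` for all `p < 1` grow
slower than every positive power of the logarithm. -/
lemma exists_sum_le_mul_log_rpow {α : ℕ → ℝ} (hα : ∀ k, 0 < α k)
    (hstep : ∀ p : ℝ, p < 1 →
      Tendsto (fun k : ℕ => (k : ℝ) * Real.log k ^ p * α k) atTop (𝓝 0))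
    {ε : ℝ} (hε : 0 < ε) (hε1 : ε ≤ 1) :
    ∃ c : ℝ, 0 < c ∧ ∀ k : ℕ, ∑ r ∈ Finset.range k, α r ≤ c * Real.log ((k : ℝ) + 3) ^ ε := by
  have hev := (hstep (1 - ε) (by linarith)).eventually (gt_mem_nhds zero_lt_one)
  obtain ⟨k₀, hk₀⟩ := eventually_atTop.1 (hev.and (eventually_ge_atTop 4))
  have hinc : ∀ k, k₀ ≤ k → α k ≤ 4 / ε *
      (Real.log ((k : ℝ) + 4) ^ ε - Real.log ((k : ℝ) + 3) ^ ε) := by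
    intro k hk
    obtain ⟨h1, h4⟩ := hk₀ k hk
    have h4' : (4 : ℝ) ≤ k := by exact_mod_cast h4
    have hlog : 0 < Real.log k := Real.log_pos (by linarith)
    have hb : Real.log ((k : ℝ) + 4) ≤ 2 * Real.log k := by
      have : 2 * Real.log (k : ℝ) = Real.log ((k : ℝ) ^ 2) := by
        rw [Real.log_pow]; norm_num
      rw [this]
      exact Real.log_le_log (by positivity) (by nlinarith)
    have hb0 : 0 < Real.log ((k : ℝ) + 4) := Real.log_pos (by linarith)
    have hb1 : Real.log ((k : ℝ) + 4) ^ (1 - ε) ≤ 2 * Real.log k ^ (1 - ε) :=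
      calc Real.log ((k : ℝ) + 4) ^ (1 - ε) ≤ (2 * Real.log k) ^ (1 - ε) :=
            Real.rpow_le_rpow hb0.le hb (by linarith)
        _ = 2 ^ (1 - ε) * Real.log k ^ (1 - ε) := Real.mul_rpow (by norm_num) hlog.le
        _ ≤ 2 * Real.log k ^ (1 - ε) := by
            gcongr
            calc (2 : ℝ) ^ (1 - ε) ≤ 2 ^ (1 : ℝ) :=
                  Real.rpow_le_rpow_of_exponent_le (by norm_num) (by linarith)
              _ = 2 := Real.rpow_one 2
    have h5 := div_mul_log_rpow_le_sub hε hε1 k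
    have hpos : 0 < ((k : ℝ) + 4) * Real.log ((k : ℝ) + 4) ^ (1 - ε) := by positivity
    have h6 : α k ≤ 4 / (((k : ℝ) + 4) * Real.log ((k : ℝ) + 4) ^ (1 - ε)) := by
      rw [le_div_iff₀ hpos]
      have h7 : ((k : ℝ) + 4) * Real.log ((k : ℝ) + 4) ^ (1 - ε)
          ≤ (2 * k) * (2 * Real.log k ^ (1 - ε)) :=
        mul_le_mul (by linarith) hb1 (by positivity) (by positivity)
      have := mul_le_mul_of_nonneg_left h7 (hα k).le
      nlinarith
    calc α k ≤ 4 / (((k : ℝ) + 4) * Real.log ((k : ℝ) + 4) ^ (1 - ε)) := h6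
      _ = 4 / ε * (ε / (((k : ℝ) + 4) * Real.log ((k : ℝ) + 4) ^ (1 - ε))) := by field_simp
      _ ≤ _ := by gcongr
  set S := ∑ r ∈ Finset.range k₀, α r
  have hS : 0 ≤ S := Finset.sum_nonneg fun r _ => (hα r).le
  have hg : ∀ k : ℕ, 1 ≤ Real.log ((k : ℝ) + 3) ^ ε := fun k =>
    Real.one_le_rpow (one_le_log_add_three k) hε.le
  have hmain : ∀ k : ℕ, ∑ r ∈ Finset.range k, α r
      ≤ S + 4 / ε * Real.log ((k : ℝ) + 3) ^ ε := by
    intro k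
    rcases le_total k k₀ with h | h
    · have h1 : ∑ r ∈ Finset.range k, α r ≤ S :=
        Finset.sum_le_sum_of_subset_of_nonneg (Finset.range_mono h) fun r _ _ => (hα r).le
      have h2 : 0 ≤ 4 / ε * Real.log ((k : ℝ) + 3) ^ ε :=
        mul_nonneg (by positivity) (zero_le_one.trans (hg k))
      linarith
    · induction k, h using Nat.le_induction with
      | base =>
        have h2 : 0 ≤ 4 / ε * Real.log ((k₀ : ℝ) + 3) ^ ε :=
          mul_nonneg (by positivity) (zero_le_one.trans (hg k₀))
        linarith
      | succ k hk ih =>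
        rw [Finset.sum_range_succ]
        have h1 := hinc k hk
        have h2 : ((k + 1 : ℕ) : ℝ) + 3 = (k : ℝ) + 4 := by push_cast; ring
        rw [h2]
        linarith
  refine ⟨S + 4 / ε, by positivity, fun k => (hmain k).trans ?_⟩
  have := hg k
  nlinarith

lemma sqrt_log_div_le {a : ℝ} (ha : 0 < a) {t : ℝ} (ht : 0 ≤ t) :
    √(Real.log (t + 1)) / a ≤ √t + 1 / (2 * a ^ 2) := by
  have hlog : 0 ≤ Real.log (t + 1) := Real.log_nonneg (by linarith)
  have h1 : Real.log (t + 1) ≤ 2 * √t := by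
    have h2 : Real.log (t + 1) ≤ Real.log ((1 + √t) ^ 2) := by
      refine Real.log_le_log (by positivity) ?_
      nlinarith [Real.sq_sqrt ht, Real.sqrt_nonneg t]
    rw [Real.log_pow] at h2
    have h3 := Real.log_le_sub_one_of_pos (x := 1 + √t) (by positivity)
    push_cast at h2
    linarith
  have h2 := Real.sq_sqrt hlog
  set q := √(Real.log (t + 1))
  have h4 : q / a = q ^ 2 / 2 + 1 / (2 * a ^ 2) - (q - 1 / a) ^ 2 / 2 := by field_simp; ring
  nlinarith [sq_nonneg (q - 1 / a)]

lemma neg_mul_div_sqrt_log_le {a : ℝ} (ha : 0 < a) (s t : ℕ) :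
    -(a * t / √(Real.log ((s : ℝ) + t + 3)))
      ≤ 1 / (2 * a ^ 2) + √(Real.log ((s : ℝ) + 3)) / a - √(t : ℝ) := by
  have hs : (0 : ℝ) ≤ s := s.cast_nonneg
  have ht : (0 : ℝ) ≤ t := t.cast_nonneg
  have hΛ : 0 < √(Real.log ((s : ℝ) + t + 3)) :=
    Real.sqrt_pos.2 (Real.log_pos (by linarith))
  have h1 : √(Real.log ((s : ℝ) + t + 3)) ≤
      √(Real.log ((s : ℝ) + 3)) + √(Real.log ((t : ℝ) + 1)) := by
    have h6 : 0 ≤ Real.log ((s : ℝ) + 3) := Real.log_nonneg (by linarith)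
    have h7 : 0 ≤ Real.log ((t : ℝ) + 1) := Real.log_nonneg (by linarith)
    refine Real.sqrt_le_iff.2 ⟨by positivity, ?_⟩
    rw [add_sq, Real.sq_sqrt h6, Real.sq_sqrt h7]
    have h8 : 0 ≤ √(Real.log ((s : ℝ) + 3)) * √(Real.log ((t : ℝ) + 1)) := by positivity
    suffices Real.log ((s : ℝ) + t + 3)
        ≤ Real.log ((s : ℝ) + 3) + Real.log ((t : ℝ) + 1) by linarith
    rw [← Real.log_mul (by positivity) (by positivity)]
    exact Real.log_le_log (by positivity) (by nlinarith)
  have h2 := sqrt_log_div_le ha ht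
  have h5 := Real.sq_sqrt ht
  set Λ := √(Real.log ((s : ℝ) + t + 3))
  set u := √(t : ℝ)
  have h3 : 2 * u ≤ a * t / Λ + Λ / a := by
    have : a * t / Λ + Λ / a - 2 * u = (a * u - Λ) ^ 2 / (a * Λ) := by
      rw [← h5]; field_simp; ring
    have : 0 ≤ (a * u - Λ) ^ 2 / (a * Λ) := by positivity
    linarith
  have h4 : Λ / a ≤ √(Real.log ((s : ℝ) + 3)) / a + √(Real.log ((t : ℝ) + 1)) / a := by
    rw [← add_div]; gcongr
  linarith

lemma eventually_mul_exp_sqrt_log_le_rpow {a D : ℝ} (ha : 0 < a) (hD : 0 < D) {q : ℝ}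
    (hq : 0 < q) :
    ∀ᶠ s : ℕ in atTop, D * Real.exp (√(Real.log ((s : ℝ) + 3)) / a) ≤ (s : ℝ) ^ q := by
  have h1 : Tendsto (fun s : ℕ => Real.log (s : ℝ)) atTop atTop :=
    Real.tendsto_log_atTop.comp tendsto_natCast_atTop_atTop
  filter_upwards [h1.eventually_ge_atTop ((Real.log D + 1 / (a ^ 2 * q)) * 2 / q),
    eventually_ge_atTop 3] with s hs h3
  have h3' : (3 : ℝ) ≤ s := by exact_mod_cast h3
  have hx : Real.log ((s : ℝ) + 3) ≤ 2 * Real.log s := by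
    have : 2 * Real.log (s : ℝ) = Real.log ((s : ℝ) ^ 2) := by
      rw [Real.log_pow]; norm_num
    rw [this]
    exact Real.log_le_log (by positivity) (by nlinarith)
  rw [div_le_iff₀ hq] at hs
  have h0 := Real.sq_sqrt (zero_le_one.trans (one_le_log_add_three s))
  set v := √(Real.log ((s : ℝ) + 3))
  have h4 : v / a ≤ q * v ^ 2 / 4 + 1 / (a ^ 2 * q) := by
    have : q * v ^ 2 / 4 + 1 / (a ^ 2 * q) - v / a = (q * v * a / 2 - 1) ^ 2 / (a ^ 2 * q) := by
      field_simp; ring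
    have : 0 ≤ (q * v * a / 2 - 1) ^ 2 / (a ^ 2 * q) := by positivity
    linarith
  rw [Real.rpow_def_of_pos (by linarith)]
  nth_rewrite 1 [← Real.exp_log hD]
  rw [← Real.exp_add, Real.exp_le_exp]
  nlinarith

lemma exists_subpolynomial_bound {a D : ℝ} (ha : 0 < a) (hD : 0 < D) :
    ∃ β : ℕ → ℝ, (∀ s, 0 ≤ β s) ∧ StrictMono β ∧
      (∃ S : ℝ → ℕ, ∀ q : ℝ, 0 < q → ∀ s : ℕ, S q ≤ s → β s ≤ (s : ℝ) ^ q) ∧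
      ∀ s t : ℕ, D * Real.exp (-(a * t / √(Real.log ((s : ℝ) + t + 3))))
        ≤ β s * Real.exp (-√(t : ℝ)) := by
  set D' := D * Real.exp (1 / (2 * a ^ 2)) with hD'
  have hD0 : 0 < D' := by positivity
  refine ⟨fun s => D' * Real.exp (√(Real.log ((s : ℝ) + 3)) / a), fun s => by positivity,
    fun s t hst => ?_, ?_, fun s t => ?_⟩
  · have hst' : (s : ℝ) < t := by exact_mod_cast hst
    have hs : (0 : ℝ) ≤ s := s.cast_nonneg
    refine mul_lt_mul_of_pos_left (Real.exp_lt_exp.2 ?_) hD0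
    refine div_lt_div_of_pos_right (Real.sqrt_lt_sqrt (Real.log_nonneg (by linarith)) ?_) ha
    exact Real.log_lt_log (by positivity) (by linarith)
  · choose! S hS using fun (q : ℝ) (hq : 0 < q) =>
      eventually_atTop.1 (eventually_mul_exp_sqrt_log_le_rpow ha hD0 hq)
    exact ⟨S, fun q hq s hs => hS q hq s hs⟩
  · rw [hD', mul_assoc, mul_assoc, ← Real.exp_add, ← Real.exp_add]
    refine mul_le_mul_of_nonneg_left (Real.exp_le_exp.2 ?_) hD.le
    have := neg_mul_div_sqrt_log_le ha s t
    linarith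

end RealBounds

section Projection

variable {n : ℕ} {X : Set (EuclideanSpace ℝ (Fin n))}

lemma projOn_spec (hne : X.Nonempty) (hcl : IsClosed X) (hcv : Convex ℝ X)
    (x : EuclideanSpace ℝ (Fin n)) :
    projOn X x ∈ X ∧ ∀ z ∈ X, inner ℝ (x - projOn X x) (z - projOn X x) ≤ 0 := by
  have hbdd : BddBelow (Set.range fun w : X => ‖x - w‖) :=
    ⟨0, Set.forall_mem_range.2 fun _ => norm_nonneg _⟩
  have hex : ∃ y, y ∈ X ∧ IsMinOn (fun z => ‖x - z‖) X y := by
    obtain ⟨v, hv, h⟩ := exists_norm_eq_iInf_of_complete_convex hne hcl.isComplete hcv x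
    refine ⟨v, hv, fun z hz => ?_⟩
    change ‖x - v‖ ≤ ‖x - z‖
    rw [h]
    exact ciInf_le hbdd ⟨z, hz⟩
  obtain ⟨h1, h2⟩ : projOn X x ∈ X ∧ IsMinOn (fun z => ‖x - z‖) X (projOn X x) :=
    Classical.epsilon_spec hex
  refine ⟨h1, (norm_eq_iInf_iff_real_inner_le_zero hcv h1).1 ?_⟩
  have : Nonempty X := hne.to_subtype
  exact le_antisymm (le_ciInf fun w => h2 w.2) (ciInf_le hbdd ⟨_, h1⟩)

lemma norm_projOn_sub_projOn_le (hne : X.Nonempty) (hcl : IsClosed X) (hcv : Convex ℝ X)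
    (x y : EuclideanSpace ℝ (Fin n)) : ‖projOn X x - projOn X y‖ ≤ ‖x - y‖ := by
  obtain ⟨hx, hx'⟩ := projOn_spec hne hcl hcv x
  obtain ⟨hy, hy'⟩ := projOn_spec hne hcl hcv y
  have h1 := hx' _ hy
  have h2 := hy' _ hx
  set p := projOn X x
  set q := projOn X y
  have h3 : inner ℝ (x - p) (q - p) + inner ℝ (y - q) (p - q)
      = ‖p - q‖ ^ 2 - inner ℝ (x - y) (p - q) := by
    rw [← real_inner_self_eq_norm_sq]
    simp only [inner_sub_left, inner_sub_right]
    ring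
  have h4 := real_inner_le_norm (x - y) (p - q)
  have h5 : ‖p - q‖ ^ 2 ≤ ‖x - y‖ * ‖p - q‖ := by linarith
  rcases (norm_nonneg (p - q)).eq_or_lt with h | h
  · rw [← h]; exact norm_nonneg _
  · nlinarith

lemma measurable_projOn (hne : X.Nonempty) (hcl : IsClosed X) (hcv : Convex ℝ X) :
    Measurable (projOn X) := by
  have : LipschitzWith 1 (projOn X) := LipschitzWith.of_dist_le_mul fun x y => by
    simpa [dist_eq_norm] using norm_projOn_sub_projOn_le hne hcl hcv x y
  exact this.continuous.measurable

end Projection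

section Noise

variable {W : Type*} [MeasurableSpace W] (P : Measure W) [IsProbabilityMeasure P]

open SubgradientNetwork

instance isProbabilityMeasure_noiseLaw : IsProbabilityMeasure (noiseLaw P) := by
  unfold noiseLaw; infer_instance

/-- Replacing one coordinate of the noise by an independent copy does not change its law. -/
lemma measurePreserving_update_noiseLaw (k : ℕ) :
    MeasurePreserving (fun q : (ℕ → W) × W => Function.update q.1 k q.2)
      ((noiseLaw P).prod P) (noiseLaw P) := by
  refine ⟨measurable_update', ?_⟩
  refine Measure.eq_infinitePi _ fun s t ht => ?_
  rw [Measure.map_apply measurable_update' (MeasurableSet.pi s.countable_toSet fun i _ => ht i)]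
  by_cases hk : k ∈ s
  · have : (fun q : (ℕ → W) × W => Function.update q.1 k q.2) ⁻¹' (Set.pi s t)
        = (Set.pi (s.erase k : Finset ℕ) t) ×ˢ t k := by
      ext q
      simp only [Set.mem_preimage, Set.mem_pi, Set.mem_prod, Finset.mem_coe, Finset.mem_erase]
      constructor
      · refine fun h => ⟨fun i hi => ?_, ?_⟩
        · simpa [hi.1] using h i hi.2
        · simpa using h k hk
      · rintro ⟨h1, h2⟩ i hi
        rcases eq_or_ne i k with rfl | hik
        · simpa using h2
        · simpa [hik] using h1 i ⟨hik, hi⟩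
    rw [this, Measure.prod_prod, noiseLaw, Measure.infinitePi_pi _ fun i _ => ht i,
      Finset.prod_erase_mul _ _ hk]
  · have : (fun q : (ℕ → W) × W => Function.update q.1 k q.2) ⁻¹' (Set.pi s t)
        = (Set.pi s t) ×ˢ Set.univ := by
      ext q
      simp only [Set.mem_preimage, Set.mem_pi, Set.mem_prod, Finset.mem_coe, Set.mem_univ,
        and_true]
      refine forall₂_congr fun i hi => ?_
      rw [Function.update_of_ne (by rintro rfl; exact hk hi)]
    rw [this, Measure.prod_prod, noiseLaw, Measure.infinitePi_pi _ fun i _ => ht i]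
    simp

lemma lintegral_noiseLaw_update (k : ℕ) {f : (ℕ → W) → ENNReal} (hf : Measurable f) :
    ∫⁻ ω, f ω ∂(noiseLaw P) = ∫⁻ ω, ∫⁻ w, f (Function.update ω k w) ∂P ∂(noiseLaw P) := by
  rw [← (measurePreserving_update_noiseLaw P k).lintegral_comp hf]
  exact lintegral_prod _ (hf.comp measurable_update').aemeasurable

lemma ae_ae_update_of_ae_noiseLaw (k : ℕ) {p : (ℕ → W) → Prop} (h : ∀ᵐ ω ∂(noiseLaw P), p ω) :
    ∀ᵐ ω ∂(noiseLaw P), ∀ᵐ w ∂P, p (Function.update ω k w) :=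
  Measure.ae_ae_of_ae_prod ((measurePreserving_update_noiseLaw P k).quasiMeasurePreserving.ae h)

end Noise

section Products

variable {m : ℕ}

/-- The product `A (s + r - 1) ⋯ A (s + 1) A s` of `r` consecutive matrices. -/
noncomputable def consecutiveProduct (A : ℕ → Matrix (Fin m) (Fin m) ℝ) (s r : ℕ) :
    Matrix (Fin m) (Fin m) ℝ :=
  ((List.range' s r).reverse.map A).prod

lemma consecutiveProduct_zero (A : ℕ → Matrix (Fin m) (Fin m) ℝ) (s : ℕ) :
    consecutiveProduct A s 0 = 1 := rfl

lemma consecutiveProduct_succ (A : ℕ → Matrix (Fin m) (Fin m) ℝ) (s r : ℕ) :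
    consecutiveProduct A s (r + 1) = A (s + r) * consecutiveProduct A s r := by
  simp [consecutiveProduct, List.range'_concat]

lemma forwardProduct_eq (A : ℕ → Matrix (Fin m) (Fin m) ℝ) (k s : ℕ) :
    forwardProduct A k s
      = (consecutiveProduct (fun t => (A t).transpose) s (k + 1 - s)).transpose := by
  rw [consecutiveProduct, forwardProduct, Matrix.transpose_list_prod, List.map_map,
    ← List.map_reverse, List.reverse_reverse]
  rfl

lemma consecutiveProduct_mem_doublyStochastic {A : ℕ → Matrix (Fin m) (Fin m) ℝ} {s : ℕ}
    (hA : ∀ t, s ≤ t → A t ∈ doublyStochastic ℝ (Fin m)) (r : ℕ) :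
    consecutiveProduct A s r ∈ doublyStochastic ℝ (Fin m) := by
  induction r with
  | zero => exact one_mem _
  | succ r ih => rw [consecutiveProduct_succ]; exact mul_mem (hA _ (by omega)) ih

lemma consecutiveProduct_congr {A B : ℕ → Matrix (Fin m) (Fin m) ℝ} {s r : ℕ}
    (h : ∀ t, t < s + r → A t = B t) : consecutiveProduct A s r = consecutiveProduct B s r := by
  induction r with
  | zero => rfl
  | succ r ih =>
    rw [consecutiveProduct_succ, consecutiveProduct_succ, h _ (by omega),
      ih fun t ht => h t (by omega)]

lemma measurable_consecutiveProduct {Ω : Type*} [MeasurableSpace Ω]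
    {A : Ω → ℕ → Matrix (Fin m) (Fin m) ℝ} (hA : ∀ t i j, Measurable fun ω => A ω t i j)
    (s r : ℕ) : ∀ i j, Measurable fun ω => consecutiveProduct (A ω) s r i j := by
  induction r with
  | zero => intro i j; simp only [consecutiveProduct_zero]; exact measurable_const
  | succ r ih =>
    intro i j
    simp only [consecutiveProduct_succ]
    exact measurable_matrix_mul (hA _) ih i j

end Products

namespace SubgradientNetwork

variable {m n : ℕ} {W : Type*} [MeasurableSpace W] (N : SubgradientNetwork m n W)

lemma stateFrom_succ {s k : ℕ} (h : s ≤ k) (y : AgentState m n) (ω : ℕ → W) :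
    N.stateFrom s y ω (k + 1) = N.step k (N.stateFrom s y ω k) (ω k) := by
  simp [stateFrom, h]

lemma stateFrom_self (s : ℕ) (y : AgentState m n) (ω : ℕ → W) : N.stateFrom s y ω s = y := by
  cases s with
  | zero => rfl
  | succ s => simp [stateFrom]

lemma stateFrom_update (s : ℕ) (y : AgentState m n) (ω : ℕ → W) (k : ℕ) (w : W) {t : ℕ}
    (ht : t ≤ k) : N.stateFrom s y (Function.update ω k w) t = N.stateFrom s y ω t := by
  induction t with
  | zero => rfl
  | succ t ih =>
    simp only [stateFrom]
    rw [ih (by omega), Function.update_of_ne (by omega)]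

lemma measurable_step (k : ℕ) :
    Measurable fun p : AgentState m n × W => N.step k p.1 p.2 := by
  refine measurable_pi_lambda _ fun i => ?_
  have h1 : ∀ j, Measurable fun p : AgentState m n × W => p.1 j := fun j =>
    (measurable_pi_apply j).comp measurable_fst
  have h2 : ∀ j, Measurable fun p : AgentState m n × W => N.ψ p.1 p.2 i j • p.1 j := fun j =>
    (N.measurable_ψ i j).fun_smul (h1 j)
  have h3 : Measurable fun p : AgentState m n × W => N.preStep k p.1 p.2 i :=
    (Finset.measurable_fun_sum _ fun j _ => h2 j).fun_sub ((N.measurable_d k i).fun_const_smul (N.α k))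
  exact (measurable_projOn (N.nonempty_X i) (N.closed_X i) (N.convex_X i)).comp h3

lemma measurable_stateFrom (s : ℕ) (y : AgentState m n) (t : ℕ) :
    Measurable fun ω : ℕ → W => N.stateFrom s y ω t := by
  induction t with
  | zero => exact measurable_const
  | succ t ih =>
    by_cases h : s ≤ t
    · have h1 : Measurable fun ω : ℕ → W => ω t := measurable_pi_apply t
      have h2 : Measurable fun ω : ℕ → W => (N.stateFrom s y ω t, ω t) := ih.prodMk h1
      have h3 := Measurable.comp (g := fun p : AgentState m n × W => N.step t p.1 p.2)
        (N.measurable_step t) h2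
      have h4 : (fun ω : ℕ → W => N.stateFrom s y ω (t + 1))
          = fun ω => N.step t (N.stateFrom s y ω t) (ω t) :=
        funext fun ω => N.stateFrom_succ h y ω
      rw [h4]
      exact h3
    · simp only [stateFrom, h, if_false]
      exact measurable_const

lemma norm_sum_smul_sub_sum_smul_le {A : Matrix (Fin m) (Fin m) ℝ}
    (hA : A ∈ doublyStochastic ℝ (Fin m)) {x : AgentState m n} {D : ℝ}
    (hx : ∀ i h, ‖x i - x h‖ ≤ D) (i h : Fin m) :
    ‖∑ j, A i j • x j - ∑ j, A h j • x j‖ ≤ D := by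
  have h0 : ∀ i j, 0 ≤ A i j := fun i j => nonneg_of_mem_doublyStochastic hA
  have h1 : ∑ j, A i j • x j - ∑ l, A h l • x l = ∑ j, ∑ l, (A i j * A h l) • (x j - x l) := by
    have h2 : ∀ j, ∑ l, (A i j * A h l) • (x j - x l)
        = A i j • x j - A i j • ∑ l, A h l • x l := fun j => by
      simp only [smul_sub, Finset.sum_sub_distrib, mul_smul, ← Finset.smul_sum]
      rw [← Finset.sum_smul, sum_row_of_mem_doublyStochastic hA, one_smul]
    rw [Finset.sum_congr rfl fun j _ => h2 j, Finset.sum_sub_distrib, ← Finset.sum_smul,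
      sum_row_of_mem_doublyStochastic hA, one_smul]
  rw [h1]
  calc _ ≤ ∑ j, ∑ l, A i j * A h l * D :=
        norm_sum_le_of_le _ fun j _ => norm_sum_le_of_le _ fun l _ => by
          rw [norm_smul, Real.norm_of_nonneg (mul_nonneg (h0 i j) (h0 h l))]
          exact mul_le_mul_of_nonneg_left (hx j l) (mul_nonneg (h0 i j) (h0 h l))
    _ = D := by
        simp only [← Finset.sum_mul, ← Finset.mul_sum, sum_row_of_mem_doublyStochastic hA,
          mul_one, one_mul]

lemma step_mem_reachable (hm : 0 < m) {L M : ℝ} (hL : 0 < L) (hM : 0 < M)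
    (hsub : ∀ i x, ∀ g ∈ subgradients (N.f i) x, ‖g‖ ≤ L) {k : ℕ} {x : AgentState m n}
    (hx : x ∈ N.reachable L M k) {w : W} (hds : N.ψ x w ∈ doublyStochastic ℝ (Fin m))
    (herr : ∀ i, ‖N.projError k x w i‖ ≤ M * N.α k) :
    N.step k x w ∈ N.reachable L M (k + 1) := by
  intro i h
  have hα := N.α_pos k
  have h1 : ∀ i, N.step k x w i
      = ∑ j, N.ψ x w i j • x j - (N.α k • N.d k i x w - N.projError k x w i) := fun i => by
    simp only [step, projError, preStep]; abel
  have h2 : ∀ i, ‖N.α k • N.d k i x w - N.projError k x w i‖ ≤ (L + M) * N.α k := fun i => by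
    refine (norm_sub_le _ _).trans ?_
    rw [norm_smul, Real.norm_of_nonneg hα.le]
    have := mul_le_mul_of_nonneg_left (hsub i _ _ (N.d_mem k i x w)) hα.le
    linarith [herr i]
  have h3 := norm_sum_smul_sub_sum_smul_le hds hx i h
  rw [h1 i, h1 h, sub_sub_sub_comm]
  refine (norm_sub_le _ _).trans ((add_le_add h3 ((norm_sub_le _ _).trans
    (add_le_add (h2 i) (h2 h)))).trans ?_)
  rw [Finset.sum_range_succ]
  have hm' : (1 : ℝ) ≤ m := by exact_mod_cast hm
  have : 0 ≤ (m - 1) * ((L + M) * N.α k) := mul_nonneg (by linarith) (by positivity)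
  nlinarith

lemma x₀_mem_reachable (hm : 0 < m) (L M : ℝ) : N.x₀ ∈ N.reachable L M 0 := by
  intro i h
  have hb : BddAbove (Set.range fun j => ‖N.x₀ j‖) := (Set.finite_range _).bddAbove
  have h1 := le_ciSup hb i
  have h2 := le_ciSup hb h
  have h3 := norm_sub_le (N.x₀ i) (N.x₀ h)
  have hm' : (1 : ℝ) ≤ m := by exact_mod_cast hm
  have h4 : 0 ≤ ⨆ j, ‖N.x₀ j‖ := Real.iSup_nonneg fun _ => norm_nonneg _
  simp only [Finset.range_zero, Finset.sum_empty, mul_zero, add_zero]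
  nlinarith

lemma ae_stateFrom_mem_reachable (hm : 0 < m) (P : Measure W) [IsProbabilityMeasure P] {L M : ℝ}
    (hL : 0 < L) (hM : 0 < M) (hsub : ∀ i x, ∀ g ∈ subgradients (N.f i) x, ‖g‖ ≤ L)
    {s : ℕ} {y : AgentState m n} (hy : y ∈ N.reachable L M s)
    (hds : N.DoublyStochasticFrom P s y) (herr : N.ProjErrorBoundedFrom P M s y) :
    ∀ᵐ ω ∂(noiseLaw P), ∀ t, s ≤ t → N.stateFrom s y ω t ∈ N.reachable L M t := by
  filter_upwards [hds, herr] with ω h1 h2 t ht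
  induction t, ht using Nat.le_induction with
  | base => rwa [stateFrom_self]
  | succ t ht ih =>
    rw [stateFrom_succ N ht]
    exact N.step_mem_reachable hm hL hM hsub ih (h1 t ht) (h2 t ht)

/-- On the reachable sets, the probability of communication along an edge decreases at most like
the inverse square root of the logarithm of the time. -/
lemma exists_le_communication_probability (hm : 0 < m) (P : Measure W) [IsProbabilityMeasure P]
    {L M : ℝ} (hL : 0 < L) (hM : 0 < M) {G : Digraph (Fin m)} {γ δ K C : ℝ}
    (hδ : δ ∈ Set.Ioc (0 : ℝ) 1) (hK : 0 < K) (hC : 0 < C)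
    (hcomm : ∀ i j, G.Adj j i → ∀ x : AgentState m n,
      min (ENNReal.ofReal δ) (ENNReal.ofReal K / ENNReal.ofReal ‖x i - x j‖ ^ C) ≤
        P {w | γ ≤ N.ψ x w i j})
    (hstep : ∀ p : ℝ, p < 1 →
      Tendsto (fun k : ℕ => (k : ℝ) * Real.log k ^ p * N.α k) atTop (𝓝 0)) :
    ∃ c : ℝ, 0 < c ∧ ∀ t : ℕ, ∀ x ∈ N.reachable L M t, ∀ i j, G.Adj j i →
      c / √(Real.log ((t : ℝ) + 3)) ≤ P.real {w | γ ≤ N.ψ x w i j} := by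
  set ε : ℝ := 1 / (2 * C + 1) with hε
  have hε0 : 0 < ε := by positivity
  have hε1 : ε ≤ 1 := by rw [hε, div_le_one (by positivity)]; linarith
  have hεC : ε * C ≤ 1 / 2 := by
    rw [hε, div_mul_eq_mul_div, div_le_div_iff₀ (by positivity) (by positivity)]; linarith
  obtain ⟨c, hc, hsum⟩ := exists_sum_le_mul_log_rpow N.α_pos hstep hε0 hε1
  have hm' : (0 : ℝ) < m := by exact_mod_cast hm
  set S := ⨆ j, ‖N.x₀ j‖
  have hS : 0 ≤ S := Real.iSup_nonneg fun _ => norm_nonneg _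
  set c₀ := 2 * m * S + 2 * m * (L + M) * c with hc₀
  have hc₀0 : 0 < c₀ := by positivity
  refine ⟨min δ (K / c₀ ^ C), lt_min hδ.1 (by positivity), fun t x hx i j hij => ?_⟩
  have hl1 := one_le_log_add_three t
  set l := Real.log ((t : ℝ) + 3)
  have hl0 : 0 < l := zero_lt_one.trans_le hl1
  have hdist : ‖x i - x j‖ ≤ c₀ * l ^ ε := by
    refine (hx i j).trans ?_
    have h1 := hsum t
    have h2 : 1 ≤ l ^ ε := Real.one_le_rpow hl1 hε0.le
    have h3 : 2 * m * (L + M) * ∑ r ∈ Finset.range t, N.α r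
        ≤ 2 * m * (L + M) * (c * l ^ ε) := mul_le_mul_of_nonneg_left h1 (by positivity)
    have h4 : 2 * m * S ≤ 2 * m * S * l ^ ε := le_mul_of_one_le_right (by positivity) h2
    rw [hc₀]; linarith
  have hpow : (c₀ * l ^ ε) ^ C ≤ c₀ ^ C * √l := by
    rw [Real.mul_rpow hc₀0.le (by positivity), ← Real.rpow_mul hl0.le, Real.sqrt_eq_rpow]
    gcongr
  rw [measureReal_def, ← ENNReal.ofReal_le_iff_le_toReal (measure_ne_top _ _)]
  refine le_trans (le_min ?_ ?_) (hcomm i j hij x)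
  · refine ENNReal.ofReal_le_ofReal ?_
    calc min δ (K / c₀ ^ C) / √l ≤ δ / √l := by gcongr; exact min_le_left _ _
      _ ≤ δ := div_le_self hδ.1.le (Real.one_le_sqrt.2 hl1)
  · calc ENNReal.ofReal (min δ (K / c₀ ^ C) / √l)
        ≤ ENNReal.ofReal (K / (c₀ * l ^ ε) ^ C) := by
          refine ENNReal.ofReal_le_ofReal ?_
          calc min δ (K / c₀ ^ C) / √l ≤ (K / c₀ ^ C) / √l := by gcongr; exact min_le_right _ _
            _ = K / (c₀ ^ C * √l) := by rw [div_div]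
            _ ≤ _ := by gcongr
      _ = ENNReal.ofReal K / ENNReal.ofReal (c₀ * l ^ ε) ^ C := by
          rw [ENNReal.ofReal_div_of_pos (by positivity),
            ENNReal.ofReal_rpow_of_pos (by positivity)]
      _ ≤ _ := by gcongr

end SubgradientNetwork

lemma condExp_le_const_of_forall_setIntegral_le {Ω : Type*} {m₁ m₀ : MeasurableSpace Ω}
    {ν : Measure Ω} [IsFiniteMeasure ν] (hm : m₁ ≤ m₀) {f : Ω → ℝ} (hf : Integrable f ν) {c : ℝ}
    (h : ∀ S, MeasurableSet[m₁] S → ∫ ω in S, f ω ∂ν ≤ c * ν.real S) :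
    ∀ᵐ ω ∂ν, (ν[f | m₁]) ω ≤ c := by
  have hle : ν[f | m₁] ≤ᵐ[ν.trim hm] fun _ => c := by
    refine ae_le_of_forall_setIntegral_le (integrable_condExp.trim hm stronglyMeasurable_condExp)
      (integrable_const c) fun S hS _ => ?_
    rw [← setIntegral_trim hm stronglyMeasurable_condExp hS, setIntegral_condExp hm hf hS,
      setIntegral_const, smul_eq_mul, mul_comm, measureReal_def, trim_measurableSet_eq hm hS,
      ← measureReal_def]
    exact h S hS
  exact ae_le_of_ae_le_trim hle

namespace SubgradientNetwork

variable {m n : ℕ} {W : Type*} [MeasurableSpace W] (N : SubgradientNetwork m n W)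

section Contraction

variable (φ : AgentState m n → W → Matrix (Fin m) (Fin m) ℝ)

/-- The product of the matrices `φ (x(t), n(t))` for `t = s, …, s + r - 1`, the latest on the left,
along the algorithm that is in state `y` at time `σ`. -/
noncomputable def weightProduct (σ : ℕ) (y : AgentState m n) (s r : ℕ) (ω : ℕ → W) :
    Matrix (Fin m) (Fin m) ℝ :=
  consecutiveProduct (fun t => φ (N.stateFrom σ y ω t) (ω t)) s r

variable {φ}

lemma measurable_weights (hφ : ∀ i j, Measurable fun p : AgentState m n × W => φ p.1 p.2 i j)
    (σ : ℕ) (y : AgentState m n) (t : ℕ) (i j : Fin m) :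
    Measurable fun ω : ℕ → W => φ (N.stateFrom σ y ω t) (ω t) i j := by
  have h1 : Measurable fun ω : ℕ → W => ω t := measurable_pi_apply t
  have h2 : Measurable fun ω : ℕ → W => (N.stateFrom σ y ω t, ω t) :=
    (N.measurable_stateFrom σ y t).prodMk h1
  exact (hφ i j).comp h2

lemma measurable_weightProduct
    (hφ : ∀ i j, Measurable fun p : AgentState m n × W => φ p.1 p.2 i j)
    (σ : ℕ) (y : AgentState m n) (s r : ℕ) (i j : Fin m) :
    Measurable fun ω : ℕ → W => N.weightProduct φ σ y s r ω i j :=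
  measurable_consecutiveProduct (A := fun (ω : ℕ → W) t => φ (N.stateFrom σ y ω t) (ω t))
    (N.measurable_weights hφ σ y) s r i j

lemma weightProduct_mem_doublyStochastic {σ s : ℕ} {y : AgentState m n} {ω : ℕ → W}
    (h : ∀ t, s ≤ t → φ (N.stateFrom σ y ω t) (ω t) ∈ doublyStochastic ℝ (Fin m)) (r : ℕ) :
    N.weightProduct φ σ y s r ω ∈ doublyStochastic ℝ (Fin m) :=
  consecutiveProduct_mem_doublyStochastic h r

lemma weightProduct_succ_update (σ : ℕ) (y : AgentState m n) (s r : ℕ) (ω : ℕ → W) (w : W) :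
    N.weightProduct φ σ y s (r + 1) (Function.update ω (s + r) w)
      = φ (N.stateFrom σ y ω (s + r)) w * N.weightProduct φ σ y s r ω := by
  rw [weightProduct, consecutiveProduct_succ, Function.update_self,
    N.stateFrom_update σ y ω _ w le_rfl, weightProduct]
  congr 1
  refine consecutiveProduct_congr fun t ht => ?_
  rw [N.stateFrom_update σ y ω _ w ht.le, Function.update_of_ne ht.ne]

/-- The expected energy of the products of weights, restricted to an event about the state at the
starting time, decreases exponentially in the sum of the communication probabilities. -/
lemma lintegral_averagingEnergy_weightProduct_le (hm : 0 < m) (P : Measure W)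
    [IsProbabilityMeasure P] (hφ : ∀ i j, Measurable fun p : AgentState m n × W => φ p.1 p.2 i j)
    {E : Fin m → Fin m → Prop} {γ c : ℝ} (hγ : 0 < γ)
    (hc : ∀ (b : Fin m → Fin m → ℝ) (p : ℝ), 0 ≤ p → (∀ i j, 0 ≤ b i j) →
      (∀ i j, E i j → p ≤ b i j) → ∀ Z ∈ doublyStochastic ℝ (Fin m),
        c * p * averagingEnergy Z ≤ ∑ l, ∑ i, ∑ j, b i j * (Z i l - Z j l) ^ 2)
    {p : ℕ → ℝ} (hp : ∀ t, 0 ≤ p t) {R : ℕ → Set (AgentState m n)}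
    (hE : ∀ t, ∀ x ∈ R t, ∀ i j, E i j → p t ≤ P.real {w | γ ≤ φ x w i j})
    {σ s : ℕ} {y : AgentState m n}
    (hds : ∀ᵐ ω ∂(noiseLaw P), ∀ t, s ≤ t →
      φ (N.stateFrom σ y ω t) (ω t) ∈ doublyStochastic ℝ (Fin m))
    (hself : ∀ᵐ ω ∂(noiseLaw P), ∀ t, s ≤ t → ∀ i, γ ≤ φ (N.stateFrom σ y ω t) (ω t) i i)
    (hR : ∀ᵐ ω ∂(noiseLaw P), ∀ t, s ≤ t → N.stateFrom σ y ω t ∈ R t)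
    {B : Set (AgentState m n)} (hB : MeasurableSet B) (r : ℕ) :
    ∫⁻ ω in (fun ω => N.stateFrom σ y ω s) ⁻¹' B,
        ENNReal.ofReal (averagingEnergy (N.weightProduct φ σ y s r ω)) ∂(noiseLaw P)
      ≤ ENNReal.ofReal (Real.exp (-(γ ^ 2 * c / 2 * ∑ t ∈ Finset.range r, p (s + t)))
          * ((m : ℝ) * m)) * noiseLaw P ((fun ω => N.stateFrom σ y ω s) ⁻¹' B) := by
  have hSB : MeasurableSet ((fun ω => N.stateFrom σ y ω s) ⁻¹' B) :=
    N.measurable_stateFrom σ y s hB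
  have hFm : ∀ r, Measurable fun ω : ℕ → W =>
      ENNReal.ofReal (averagingEnergy (N.weightProduct φ σ y s r ω)) := fun r =>
    (measurable_averagingEnergy (N.measurable_weightProduct hφ σ y s r)).ennreal_ofReal
  induction r with
  | zero =>
    rw [← setLIntegral_const]
    refine lintegral_mono fun ω => ENNReal.ofReal_le_ofReal ?_
    simpa [weightProduct, consecutiveProduct_zero] using averagingEnergy_le hm (one_mem (doublyStochastic ℝ (Fin m)))
  | succ r ih =>
    have hind : ∀ (ω : ℕ → W) w, B.indicator (fun _ => (1 : ENNReal))
        (N.stateFrom σ y (Function.update ω (s + r) w) s)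
          = B.indicator (fun _ => (1 : ENNReal)) (N.stateFrom σ y ω s) := fun ω w => by
      rw [N.stateFrom_update σ y ω _ w (by omega)]
    have hset : ∀ r, ∫⁻ ω in (fun ω => N.stateFrom σ y ω s) ⁻¹' B,
        ENNReal.ofReal (averagingEnergy (N.weightProduct φ σ y s r ω)) ∂(noiseLaw P)
        = ∫⁻ ω, B.indicator (fun _ => (1 : ENNReal)) (N.stateFrom σ y ω s) *
          ENNReal.ofReal (averagingEnergy (N.weightProduct φ σ y s r ω)) ∂(noiseLaw P) := by
      intro r
      rw [← lintegral_indicator hSB]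
      refine lintegral_congr fun ω => ?_
      by_cases h : N.stateFrom σ y ω s ∈ B
      · rw [Set.indicator_of_mem (by exact h), Set.indicator_of_mem h, one_mul]
      · rw [Set.indicator_of_notMem (by exact h), Set.indicator_of_notMem h, zero_mul]
    have hImeas : Measurable fun ω : ℕ → W =>
        B.indicator (fun _ => (1 : ENNReal)) (N.stateFrom σ y ω s) :=
      (measurable_const.indicator hB).comp (N.measurable_stateFrom σ y s)
    set κ := γ ^ 2 * c / 2 with hκ
    have hone : ∀ᵐ ω ∂(noiseLaw P),
        ∫⁻ w, ENNReal.ofReal (averagingEnergy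
          (φ (N.stateFrom σ y ω (s + r)) w * N.weightProduct φ σ y s r ω)) ∂P
        ≤ ENNReal.ofReal (Real.exp (-(κ * p (s + r)))) *
          ENNReal.ofReal (averagingEnergy (N.weightProduct φ σ y s r ω)) := by
      filter_upwards [hds, hR, ae_ae_update_of_ae_noiseLaw P (s + r) hds,
        ae_ae_update_of_ae_noiseLaw P (s + r) hself] with ω h1 h2 h3 h4
      have h5 := integral_averagingEnergy_mul_le hm P hγ (hp (s + r)) hc
        (A := fun w => φ (N.stateFrom σ y ω (s + r)) w)
        (fun i j => (hφ i j).comp measurable_prodMk_left)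
        (by
          filter_upwards [h3] with w hw
          simpa [N.stateFrom_update σ y ω _ w le_rfl] using hw (s + r) (by omega))
        (by
          filter_upwards [h4] with w hw
          simpa [N.stateFrom_update σ y ω _ w le_rfl] using hw (s + r) (by omega))
        (hE (s + r) _ (h2 (s + r) (by omega)))
        (N.weightProduct_mem_doublyStochastic h1 r)
      rw [← ENNReal.ofReal_mul (Real.exp_pos _).le]
      rw [← ofReal_integral_eq_lintegral_ofReal h5.1
        (Eventually.of_forall fun _ => averagingEnergy_nonneg _)]
      exact ENNReal.ofReal_le_ofReal h5.2
    have hstep : ∫⁻ ω, B.indicator (fun _ => (1 : ENNReal)) (N.stateFrom σ y ω s) *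
          ENNReal.ofReal (averagingEnergy (N.weightProduct φ σ y s (r + 1) ω)) ∂(noiseLaw P)
        ≤ ENNReal.ofReal (Real.exp (-(κ * p (s + r)))) *
          ∫⁻ ω, B.indicator (fun _ => (1 : ENNReal)) (N.stateFrom σ y ω s) *
          ENNReal.ofReal (averagingEnergy (N.weightProduct φ σ y s r ω)) ∂(noiseLaw P) := by
      rw [lintegral_noiseLaw_update P (s + r) (hImeas.fun_mul (hFm (r + 1))),
        ← lintegral_const_mul _ (hImeas.fun_mul (hFm r))]
      refine lintegral_mono_ae ?_
      filter_upwards [hone] with ω hω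
      simp only [hind, weightProduct_succ_update]
      have hmeas : Measurable fun w => ENNReal.ofReal (averagingEnergy
          (φ (N.stateFrom σ y ω (s + r)) w * N.weightProduct φ σ y s r ω)) := by
        refine (measurable_averagingEnergy
          (Q := fun w => φ (N.stateFrom σ y ω (s + r)) w * N.weightProduct φ σ y s r ω)
          (measurable_matrix_mul (R := fun _ => N.weightProduct φ σ y s r ω)
            (fun i j => (hφ i j).comp measurable_prodMk_left)
            fun _ _ => measurable_const)).ennreal_ofReal
      rw [lintegral_const_mul _ hmeas, mul_left_comm]
      gcongr
    rw [hset] at ih ⊢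
    refine hstep.trans ((mul_le_mul_right ih _).trans_eq ?_)
    rw [← mul_assoc, ← ENNReal.ofReal_mul (Real.exp_pos _).le, ← mul_assoc, ← Real.exp_add,
      Finset.sum_range_succ]
    congr 4
    ring

lemma setIntegral_disagreement_weightProduct_le (hm : 0 < m) (P : Measure W)
    [IsProbabilityMeasure P] (hφ : ∀ i j, Measurable fun p : AgentState m n × W => φ p.1 p.2 i j)
    {E : Fin m → Fin m → Prop} {γ c : ℝ} (hγ : 0 < γ)
    (hc : ∀ (b : Fin m → Fin m → ℝ) (p : ℝ), 0 ≤ p → (∀ i j, 0 ≤ b i j) →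
      (∀ i j, E i j → p ≤ b i j) → ∀ Z ∈ doublyStochastic ℝ (Fin m),
        c * p * averagingEnergy Z ≤ ∑ l, ∑ i, ∑ j, b i j * (Z i l - Z j l) ^ 2)
    {p : ℕ → ℝ} (hp : ∀ t, 0 ≤ p t) {R : ℕ → Set (AgentState m n)}
    (hE : ∀ t, ∀ x ∈ R t, ∀ i j, E i j → p t ≤ P.real {w | γ ≤ φ x w i j})
    {σ s : ℕ} {y : AgentState m n}
    (hds : ∀ᵐ ω ∂(noiseLaw P), ∀ t, s ≤ t →
      φ (N.stateFrom σ y ω t) (ω t) ∈ doublyStochastic ℝ (Fin m))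
    (hself : ∀ᵐ ω ∂(noiseLaw P), ∀ t, s ≤ t → ∀ i, γ ≤ φ (N.stateFrom σ y ω t) (ω t) i i)
    (hR : ∀ᵐ ω ∂(noiseLaw P), ∀ t, s ≤ t → N.stateFrom σ y ω t ∈ R t) (r : ℕ) :
    Integrable (fun ω => disagreement (N.weightProduct φ σ y s r ω)) (noiseLaw P) ∧
    ∀ B : Set (AgentState m n), MeasurableSet B →
      ∫ ω in (fun ω => N.stateFrom σ y ω s) ⁻¹' B,
        disagreement (N.weightProduct φ σ y s r ω) ∂(noiseLaw P)
      ≤ m * Real.exp (-(γ ^ 2 * c / 4 * ∑ t ∈ Finset.range r, p (s + t)))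
          * (noiseLaw P).real ((fun ω => N.stateFrom σ y ω s) ⁻¹' B) := by
  have hZ : ∀ᵐ ω ∂(noiseLaw P), N.weightProduct φ σ y s r ω ∈ doublyStochastic ℝ (Fin m) := by
    filter_upwards [hds] with ω h using N.weightProduct_mem_doublyStochastic h r
  have hint : Integrable (fun ω => disagreement (N.weightProduct φ σ y s r ω)) (noiseLaw P) := by
    refine Integrable.of_bound (measurable_disagreement
      (N.measurable_weightProduct hφ σ y s r)).aestronglyMeasurable 1 ?_
    filter_upwards [hZ] with ω h
    rw [Real.norm_of_nonneg (disagreement_nonneg _)]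
    exact disagreement_le_one hm h
  have hintF : Integrable (fun ω => averagingEnergy (N.weightProduct φ σ y s r ω))
      (noiseLaw P) := by
    refine Integrable.of_bound (measurable_averagingEnergy
      (N.measurable_weightProduct hφ σ y s r)).aestronglyMeasurable ((m : ℝ) * m) ?_
    filter_upwards [hZ] with ω h
    rw [Real.norm_of_nonneg (averagingEnergy_nonneg _)]
    exact averagingEnergy_le hm h
  refine ⟨hint, fun B hB => ?_⟩
  set T := (fun ω => N.stateFrom σ y ω s) ⁻¹' B
  set τ := ∑ t ∈ Finset.range r, p (s + t)
  have h1 := N.lintegral_averagingEnergy_weightProduct_le hm P hφ hγ hc hp hE hds hself hR hB r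
  rw [← ofReal_integral_eq_lintegral_ofReal hintF.integrableOn
    (Eventually.of_forall fun _ => averagingEnergy_nonneg _), ← ofReal_measureReal,
    ← ENNReal.ofReal_mul (by positivity), ENNReal.ofReal_le_ofReal_iff (by positivity)] at h1
  have hm' : (0 : ℝ) < m := by exact_mod_cast hm
  set θ := m * Real.exp (-(γ ^ 2 * c / 4 * τ)) with hθ
  have hθ0 : 0 < θ := by positivity
  have hθ2 : Real.exp (-(γ ^ 2 * c / 2 * τ)) * ((m : ℝ) * m) = θ ^ 2 := by
    rw [hθ, mul_pow, ← Real.exp_nat_mul]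
    rw [show ((2 : ℕ) : ℝ) * -(γ ^ 2 * c / 4 * τ) = -(γ ^ 2 * c / 2 * τ) by push_cast; ring]
    ring
  rw [hθ2] at h1
  have h2 : ∫ ω in T, disagreement (N.weightProduct φ σ y s r ω) ∂(noiseLaw P)
      ≤ ∫ ω in T, (θ / 2 + 1 / (2 * θ) * averagingEnergy (N.weightProduct φ σ y s r ω))
        ∂(noiseLaw P) := by
    refine integral_mono hint.integrableOn
      ((integrable_const _).add (hintF.integrableOn.const_mul _)) fun ω => ?_
    have h3 := disagreement_sq_le_averagingEnergy (N.weightProduct φ σ y s r ω)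
    change disagreement (N.weightProduct φ σ y s r ω) ≤ _
    set ρ := disagreement (N.weightProduct φ σ y s r ω)
    have h4 : ρ = θ / 2 + 1 / (2 * θ) * ρ ^ 2 - (ρ - θ) ^ 2 / (2 * θ) := by field_simp; ring
    have h5 : 0 ≤ (ρ - θ) ^ 2 / (2 * θ) := by positivity
    have h6 : 1 / (2 * θ) * ρ ^ 2
        ≤ 1 / (2 * θ) * averagingEnergy (N.weightProduct φ σ y s r ω) :=
      mul_le_mul_of_nonneg_left h3 (by positivity)
    linarith
  rw [integral_add (integrable_const _) (hintF.integrableOn.const_mul _), integral_const_mul,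
    setIntegral_const, smul_eq_mul] at h2
  have h7 := mul_le_mul_of_nonneg_left h1 (show 0 ≤ 1 / (2 * θ) by positivity)
  have h8 : 1 / (2 * θ) * (θ ^ 2 * (noiseLaw P).real T) = θ / 2 * (noiseLaw P).real T := by
    field_simp
  linarith

end Contraction

end SubgradientNetwork

lemma mul_div_sqrt_log_le_sum {c : ℝ} (hc : 0 < c) (s t : ℕ) :
    t * (c / √(Real.log ((s : ℝ) + t + 3)))
      ≤ ∑ u ∈ Finset.range (t + 1), c / √(Real.log (((s + u : ℕ) : ℝ) + 3)) := by
  have hl : ∀ u : ℕ, 0 < √(Real.log ((u : ℝ) + 3)) := fun u =>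
    Real.sqrt_pos.2 (zero_lt_one.trans_le (one_le_log_add_three u))
  have h1 : ∀ u ∈ Finset.range (t + 1), c / √(Real.log ((s : ℝ) + t + 3))
      ≤ c / √(Real.log (((s + u : ℕ) : ℝ) + 3)) := fun u hu => by
    have hut : (u : ℝ) ≤ t := by exact_mod_cast Nat.lt_succ_iff.1 (Finset.mem_range.1 hu)
    refine div_le_div_of_nonneg_left hc.le (hl _) (Real.sqrt_le_sqrt (Real.log_le_log ?_ ?_))
    · positivity
    · push_cast; linarith
  have h2 := Finset.card_nsmul_le_sum _ _ _ h1
  have h3 : 0 ≤ c / √(Real.log ((s : ℝ) + t + 3)) := by positivity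
  rw [Finset.card_range, nsmul_eq_mul] at h2
  push_cast at h2 ⊢
  linarith

lemma mul_exp_neg_sum_le {a κ c D b : ℝ} (ha : a ≤ κ * c) (hκ : 0 < κ) (hc : 0 < c) (hD : 0 < D)
    {s k : ℕ} (hsk : s ≤ k)
    (hb : ∀ t : ℕ, D * Real.exp (-(a * t / √(Real.log ((s : ℝ) + t + 3))))
        ≤ b * Real.exp (-√(t : ℝ))) :
    D * Real.exp (-(κ * ∑ u ∈ Finset.range (k + 1 - s),
        c / √(Real.log (((s + u : ℕ) : ℝ) + 3))))
      ≤ b * Real.exp (-1 * √((k : ℝ) - s)) := by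
  obtain ⟨t, rfl⟩ := Nat.exists_eq_add_of_le hsk
  have h1 : s + t + 1 - s = t + 1 := by omega
  have h2 : ((s + t : ℕ) : ℝ) - s = t := by push_cast; ring
  rw [h1, h2, neg_one_mul]
  refine le_trans (mul_le_mul_of_nonneg_left (Real.exp_le_exp.2 (neg_le_neg ?_)) hD.le) (hb t)
  calc a * t / √(Real.log ((s : ℝ) + t + 3)) ≤ κ * c * t / √(Real.log ((s : ℝ) + t + 3)) := by
        gcongr
    _ = κ * (t * (c / √(Real.log ((s : ℝ) + t + 3)))) := by ring
    _ ≤ _ := mul_le_mul_of_nonneg_left (mul_div_sqrt_log_le_sum hc s t) hκ.le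

lemma reflTransGen_reverse {V : Type*} {E : V → V → Prop}
    (h : ∀ i j, Relation.ReflTransGen E i j) (i j : V) :
    Relation.ReflTransGen (fun i j => E j i) i j :=
  (h j i).swap

theorem mainTheorem3 {m n : ℕ} (hm : 0 < m) {W : Type*} [MeasurableSpace W]
    (P : Measure W) [IsProbabilityMeasure P] (N : SubgradientNetwork m n W)
    -- bounded subgradients
    (L : ℝ) (hL : 0 < L) (hsub : ∀ i x, ∀ g ∈ subgradients (N.f i) x, ‖g‖ ≤ L)
    -- strongly connected communication graph; an edge `(j, i)` is `G.Adj j i`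
    (G : Digraph (Fin m)) (hconn : ∀ i j, Relation.ReflTransGen G.Adj i j)
    -- probability of communication along the edges, with `K / 0 = ∞`
    (γ δ K C : ℝ) (hγ : 0 < γ) (hδ : δ ∈ Set.Ioc (0 : ℝ) 1) (hK : 0 < K) (hC : 0 < C)
    (hcomm : ∀ i j, G.Adj j i → ∀ x : AgentState m n,
      min (ENNReal.ofReal δ) (ENNReal.ofReal K / ENNReal.ofReal ‖x i - x j‖ ^ C) ≤
        P {w | γ ≤ N.ψ x w i j})
    -- doubly stochastic weights, self confidence
    (hds : N.DoublyStochasticFrom P 0 N.x₀) (hself : N.SelfConfidentFrom P γ 0 N.x₀)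
    -- limiting stepsizes
    (hstep : ∀ p : ℝ, p < 1 →
      Tendsto (fun k : ℕ => (k : ℝ) * Real.log k ^ p * N.α k) atTop (𝓝 0))
    -- bounded projection errors
    (M : ℝ) (hM : 0 < M) (herr : N.ProjErrorBoundedFrom P M 0 N.x₀) :
    ∃ μ : ℝ, 0 < μ ∧ ∃ β : ℕ → ℝ, (∀ s, 0 ≤ β s) ∧ StrictMono β ∧
      (∃ S : ℝ → ℕ, ∀ q : ℝ, 0 < q → ∀ s : ℕ, S q ≤ s → β s ≤ (s : ℝ) ^ q) ∧
      ∀ Φ ∈ ({backwardProduct, forwardProduct} :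
          Set ((ℕ → Matrix (Fin m) (Fin m) ℝ) → ℕ → ℕ → Matrix (Fin m) (Fin m) ℝ)),
        ∀ k s : ℕ, s ≤ k →
          -- the bound given `x(s) = y`, for every `y` in `R_M(s)` (Markov transition law)
          (∀ y ∈ N.reachable L M s,
            N.DoublyStochasticFrom P s y → N.SelfConfidentFrom P γ s y →
            N.ProjErrorBoundedFrom P M s y →
            Integrable (fun ω => disagreement (Φ (N.weightsFrom s y ω) k s))
                (SubgradientNetwork.noiseLaw P) ∧
              ∫ ω, disagreement (Φ (N.weightsFrom s y ω) k s) ∂(SubgradientNetwork.noiseLaw P)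
                ≤ β s * Real.exp (-μ * Real.sqrt ((k : ℝ) - s))) ∧
          -- the bound on the conditional expectation given `x(s)`, for the algorithm from `x₀`
          Integrable (fun ω => disagreement (Φ (N.weightsFrom 0 N.x₀ ω) k s))
              (SubgradientNetwork.noiseLaw P) ∧
          ∀ᵐ ω ∂(SubgradientNetwork.noiseLaw P),
            ((SubgradientNetwork.noiseLaw P)[fun ω' =>
                disagreement (Φ (N.weightsFrom 0 N.x₀ ω') k s) |
              MeasurableSpace.comap (fun ω' => N.stateFrom 0 N.x₀ ω' s) inferInstance]) ω
              ≤ β s * Real.exp (-μ * Real.sqrt ((k : ℝ) - s)) := by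
  obtain ⟨c₁, hc₁, hP₁⟩ := exists_mul_averagingEnergy_le hm (reflTransGen_reverse hconn)
  obtain ⟨c₂, hc₂, hP₂⟩ := exists_mul_averagingEnergy_le hm hconn
  obtain ⟨c, hc, hprob⟩ := N.exists_le_communication_probability hm P hL hM hδ hK hC hcomm hstep
  have hm' : (0 : ℝ) < m := by exact_mod_cast hm
  have hκ₁ : 0 < γ ^ 2 * c₁ / 4 := by positivity
  have hκ₂ : 0 < γ ^ 2 * c₂ / 4 := by positivity
  obtain ⟨β, hβ0, hβmono, hβpow, hβ⟩ := exists_subpolynomial_bound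
    (lt_min (mul_pos hκ₁ hc) (mul_pos hκ₂ hc)) hm'
  refine ⟨1, one_pos, β, hβ0, hβmono, hβpow, fun Φ hΦ k s hsk => ?_⟩
  have claim : ∀ σ y, σ ≤ s → y ∈ N.reachable L M σ → N.DoublyStochasticFrom P σ y →
      N.SelfConfidentFrom P γ σ y → N.ProjErrorBoundedFrom P M σ y →
      Integrable (fun ω => disagreement (Φ (N.weightsFrom σ y ω) k s))
        (SubgradientNetwork.noiseLaw P) ∧
      ∀ B : Set (AgentState m n), MeasurableSet B →
        ∫ ω in (fun ω => N.stateFrom σ y ω s) ⁻¹' B,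
          disagreement (Φ (N.weightsFrom σ y ω) k s) ∂(SubgradientNetwork.noiseLaw P)
        ≤ β s * Real.exp (-1 * √((k : ℝ) - s))
          * (SubgradientNetwork.noiseLaw P).real ((fun ω => N.stateFrom σ y ω s) ⁻¹' B) := by
    intro σ y hσ hy hds' hself' herr'
    have hR : ∀ᵐ ω ∂(SubgradientNetwork.noiseLaw P), ∀ t, s ≤ t →
        N.stateFrom σ y ω t ∈ N.reachable L M t := by
      filter_upwards [N.ae_stateFrom_mem_reachable hm P hL hM hsub hy hds' herr'] with ω h t ht
        using h t (hσ.trans ht)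
    have hp : ∀ t : ℕ, 0 ≤ c / √(Real.log ((t : ℝ) + 3)) := fun t => by positivity
    have hds'' : ∀ᵐ ω ∂(SubgradientNetwork.noiseLaw P), ∀ t, s ≤ t →
        N.ψ (N.stateFrom σ y ω t) (ω t) ∈ doublyStochastic ℝ (Fin m) := by
      filter_upwards [hds'] with ω h t ht using h t (hσ.trans ht)
    have hself'' : ∀ᵐ ω ∂(SubgradientNetwork.noiseLaw P), ∀ t, s ≤ t → ∀ i,
        γ ≤ N.ψ (N.stateFrom σ y ω t) (ω t) i i := by
      filter_upwards [hself'] with ω h t ht using h t (hσ.trans ht)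
    rcases hΦ with rfl | rfl
    · obtain ⟨h1, h2⟩ := N.setIntegral_disagreement_weightProduct_le hm P N.measurable_ψ hγ hP₁ hp
        hprob hds'' hself'' hR (k + 1 - s)
      refine ⟨h1, fun B hB => (h2 B hB).trans ?_⟩
      exact mul_le_mul_of_nonneg_right
        (mul_exp_neg_sum_le (min_le_left _ _) hκ₁ hc hm' hsk (hβ s)) measureReal_nonneg
    · have hfwd : ∀ ω, disagreement (forwardProduct (N.weightsFrom σ y ω) k s) = disagreement
          (N.weightProduct (fun x w => (N.ψ x w).transpose) σ y s (k + 1 - s) ω) := fun ω => by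
        rw [forwardProduct_eq, disagreement_transpose]; rfl
      obtain ⟨h1, h2⟩ := N.setIntegral_disagreement_weightProduct_le
        (φ := fun x w => (N.ψ x w).transpose) hm P (fun i j => N.measurable_ψ j i) hγ hP₂ hp
        (fun t x hx i j hij => hprob t x hx j i hij)
        (by
          filter_upwards [hds''] with ω h t ht
          exact transpose_mem_doublyStochastic_iff.2 (h t ht))
        hself'' hR (k + 1 - s)
      simp only [hfwd]
      refine ⟨h1, fun B hB => (h2 B hB).trans ?_⟩
      exact mul_le_mul_of_nonneg_right
        (mul_exp_neg_sum_le (min_le_right _ _) hκ₂ hc hm' hsk (hβ s)) measureReal_nonneg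
  refine ⟨fun y hy h1 h2 h3 => ?_, ?_⟩
  · obtain ⟨h4, h5⟩ := claim s y le_rfl hy h1 h2 h3
    exact ⟨h4, by simpa using h5 Set.univ MeasurableSet.univ⟩
  · obtain ⟨h4, h5⟩ := claim 0 N.x₀ (Nat.zero_le s) (N.x₀_mem_reachable hm L M) hds hself herr
    refine ⟨h4, condExp_le_const_of_forall_setIntegral_le
      (N.measurable_stateFrom 0 N.x₀ s).comap_le h4 ?_⟩
    rintro _ ⟨B, hB, rfl⟩
    exact h5 B hB
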